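/- Let $\mathbb{K}$ be a field and let $q\in\mathbb{K}\setminus\{0\}$ be an element which is not a root of unity. Let $\mathcal{A}$ be the quantum spatial ageing algebra, that is, the associative unital $\mathbb{K}$-algebra generated by $E, K, K^{-1}, X, Y$ subject to the defining relations $KK^{-1}=K^{-1}K=1$ and $$EK=q^{-2}KE,\quad XK=q^{-1}KX,\quad YK=qKY,\quad EX=qXE,\quad EY=X+q^{-1}YE,\quad qYX=XY,$$ and let $\varphi=EY-qYE\in\mathcal{A}$. For $a,b,\ldots\in\mathcal{A}$ write $(a,b,\ldots)$ for the two-sided ideal of $\mathcal{A}$ that they generate. Let $\mathrm{Max}(\mathcal{A})$ be the set of maximal two-sided ideals of $\mathcal{A}$, and let $\mathrm{Prim}(\mathcal{A})$ be the set of primitive ideals of $\mathcal{A}$, i.e. of the annihilators of simple left $\mathcal{A}$-modules. Then $$\mathrm{Prim}(\mathcal{A})=\mathrm{Max}(\mathcal{A})\ \sqcup\ \{(Y),\,(E),\,0\},$$ where the union is disjoint and the ideals $(Y)$, $(E)$ and $0$ are pairwise distinct. The ideals $(X)$, $(\varphi)$ and $(Y,E)$ are prime ideals of $\mathcal{A}$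 that are not primitive. (A proper two-sided ideal $P$ is prime if $IJ\subseteq P$ implies $I\subseteq P$ or $J\subseteq P$ for all two-sided ideals $I,J$.) -/

import Mathlib

universe u

namespace QuantumAgeing

/-- The five generators of the quantum spatial ageing algebra; `Kinv` stands for `K⁻¹`. -/
inductive Gen : Type
  | E | K | Kinv | X | Y

section Presentation

variable {𝕜 : Type u} [Field 𝕜]

/-- A generator, as an element of the free associative algebra on the five generators. -/
abbrev free (𝕜 : Type u) [Field 𝕜] (g : Gen) : FreeAlgebra 𝕜 Gen := FreeAlgebra.ι 𝕜 g

/-- The defining relations of the quantum spatial ageing algebra. -/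
inductive Rel (q : 𝕜) : FreeAlgebra 𝕜 Gen → FreeAlgebra 𝕜 Gen → Prop
  | K_mul_Kinv : Rel q (free 𝕜 .K * free 𝕜 .Kinv) 1
  | Kinv_mul_K : Rel q (free 𝕜 .Kinv * free 𝕜 .K) 1
  | E_mul_K : Rel q (free 𝕜 .E * free 𝕜 .K) ((q ^ 2)⁻¹ • (free 𝕜 .K * free 𝕜 .E))
  | X_mul_K : Rel q (free 𝕜 .X * free 𝕜 .K) (q⁻¹ • (free 𝕜 .K * free 𝕜 .X))
  | Y_mul_K : Rel q (free 𝕜 .Y * free 𝕜 .K) (q • (free 𝕜 .K * free 𝕜 .Y))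
  | E_mul_X : Rel q (free 𝕜 .E * free 𝕜 .X) (q • (free 𝕜 .X * free 𝕜 .E))
  | E_mul_Y : Rel q (free 𝕜 .E * free 𝕜 .Y) (free 𝕜 .X + q⁻¹ • (free 𝕜 .Y * free 𝕜 .E))
  | Y_mul_X : Rel q (q • (free 𝕜 .Y * free 𝕜 .X)) (free 𝕜 .X * free 𝕜 .Y)

/-- The quantum spatial ageing algebra: the associative unital `𝕜`-algebra generated by
`E, K, K⁻¹, X, Y` subject to the defining relations. -/
abbrev Alg (q : 𝕜) : Type u := RingQuot (Rel q)

/-- The image of a generator in the quantum spatial ageing algebra. -/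
def gen (q : 𝕜) (g : Gen) : Alg q := RingQuot.mkAlgHom 𝕜 (Rel q) (free 𝕜 g)

/-- The element `X`. -/
abbrev X (q : 𝕜) : Alg q := gen q .X

/-- The element `Y`. -/
abbrev Y (q : 𝕜) : Alg q := gen q .Y

/-- The element `E`. -/
abbrev E (q : 𝕜) : Alg q := gen q .E

/-- The element `φ = EY - qYE`. -/
def phi (q : 𝕜) : Alg q := E q * Y q - q • (Y q * E q)

end Presentation

section Ideals

variable {R : Type u} [Ring R]

/-- A two-sided ideal `P` of a (not necessarily commutative) ring is prime if it is proper and, for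
two-sided ideals `I`, `J`, an inclusion `IJ ⊆ P` implies `I ⊆ P` or `J ⊆ P`. -/
def IsPrimeIdeal (P : TwoSidedIdeal R) : Prop :=
  P ≠ ⊤ ∧ ∀ I J : TwoSidedIdeal R, (∀ x ∈ I, ∀ y ∈ J, x * y ∈ P) → I ≤ P ∨ J ≤ P

/-- A two-sided ideal is (left) primitive if it is the annihilator of a simple left module.
A simple module is a quotient of `R`, so that modules in the universe of `R` suffice. -/
def IsPrimitiveIdeal (P : TwoSidedIdeal R) : Prop :=
  ∃ (M : Type u) (_ : AddCommGroup M) (_ : Module R M),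
    IsSimpleModule R M ∧ P.asIdeal = Module.annihilator R M

variable (R)

/-- The primitive spectrum: the set of all primitive ideals. -/
def Prim : Set (TwoSidedIdeal R) := {P | IsPrimitiveIdeal P}

/-- The maximal spectrum: the set of all maximal (proper) two-sided ideals. -/
def Max : Set (TwoSidedIdeal R) := {P | IsCoatom P}

end Ideals

end QuantumAgeing

/-! The proof rests on two normal elements: `X` and `φ = X + (q⁻¹ - q)YE` commute with every
generator up to a power of `q`. Since `q² ≠ 1`, both `YE` and `EY` are combinations of `X` and `φ`,
so the monomials `KⁿYᵐXⁱφʲ`, with `Yᵐ` read as `E⁻ᵐ` for negative `m`, span the algebra; their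
linear independence is never needed. As `q` is not a root of unity, elements of a two-sided ideal
can be split into weight components for `q`-commuting elements. This isolates one monomial, and
commuting with `E` or `Y` then trades its powers of `Y` or `E` for powers of `X`. Hence every
nonzero ideal contains some `Xⁱφʲ` (`exists_X_pow_mul_phi_pow_mem`).

A primitive ideal is prime, and nonzero normal elements of a prime quotient are regular, so a
nonzero primitive ideal contains `X` or `φ` (`X_mem_or_phi_mem`). Modulo either of them, `E`, `Y`,
`K` satisfy `EY = q^ε YE` with `ε = -1` or `ε = 1`, and `z = K^ε Y²E` is central; a weight component
is a polynomial in `z` up to units and powers of `Y`. On a simple module `z` is algebraic, by a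
Nullstellensatz over an arbitrary field deduced from generic freeness
(`exists_aeval_eq_zero_of_irreducible`). So the image of `k[z]` modulo the ideal is a field, and the
ideal is maximal as soon as it contains neither `E` nor `Y` (`isCoatom_of_isQuantumSpace`). A
primitive ideal containing `Y` is `(Y)` or also contains `E`, and symmetrically for `E`; above `(Y,
E)` the quotient is commutative, and primitive means maximal.

Conversely, maximal ideals are primitive, and `(Y)`, `(E)`, `0` are kernels of explicit irreducible
representations by shifts and diagonal operators, in which `E`, respectively `Y`, respectively both
`X` and `φ`, are invertible. The ideals `(X)` and `(φ)` are prime because every larger ideal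
contains some `Y^d p(z)` with `p ≠ 0`, which acts injectively on a free `k[t]`-module killed by the
ideal; `(Y, E)` is the kernel of a map to Laurent polynomials. If one of these three were primitive
it would be maximal, yet each lies strictly inside the kernel of the character `E, X, Y ↦ 0`, `K ↦
1`. -/

namespace QuantumAgeing

/-! ### Commutation up to powers of `q`, and weight components in two-sided ideals -/

section QCommutation

variable {k R : Type*} [Field k] [Ring R] [Algebra k R]

/-- `a` and `b` commute up to the `n`-th power of `q`. -/
def QComm (q : k) (n : ℤ) (a b : R) : Prop := a * b = q ^ n • (b * a)

/-- `a` and `b` agree up to a power of `q`. -/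
def QSim (q : k) (a b : R) : Prop := ∃ e : ℤ, a = q ^ e • b

variable {q : k} {a b c d : R} {m n : ℤ}

theorem QComm.congr (h : QComm q n a b) (e : n = m) : QComm q m a b := e ▸ h

theorem QComm.symm (hq0 : q ≠ 0) (h : QComm q n a b) : QComm q (-n) b a := by
  unfold QComm at *
  rw [h, smul_smul, ← zpow_add₀ hq0]
  simp

theorem QComm.mul_right (hq0 : q ≠ 0) (h : QComm q n a b) (h' : QComm q m a c) :
    QComm q (n + m) a (b * c) := by
  unfold QComm at *
  rw [← mul_assoc, h, smul_mul_assoc, mul_assoc, h', mul_smul_comm, smul_smul, zpow_add₀ hq0,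
    mul_assoc]

theorem QComm.mul_left (hq0 : q ≠ 0) (h : QComm q n a c) (h' : QComm q m b c) :
    QComm q (n + m) (a * b) c := by
  have := ((h.symm hq0).mul_right hq0 (h'.symm hq0)).symm hq0
  exact this.congr (by ring)

theorem QComm.one_right (a : R) : QComm q 0 a 1 := by simp [QComm]

theorem QComm.refl (a : R) : QComm q 0 a a := by simp [QComm]

theorem QComm.smul_right (h : QComm q n a b) (t : k) : QComm q n a (t • b) := by
  unfold QComm at *
  rw [mul_smul_comm, h, smul_mul_assoc, smul_comm]

theorem QComm.pow_right (hq0 : q ≠ 0) (h : QComm q n a b) (i : ℕ) : QComm q (n * i) a (b ^ i) := by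
  induction i with
  | zero => simpa using QComm.one_right a
  | succ i ih =>
    rw [pow_succ]
    exact (ih.mul_right hq0 h).congr (by push_cast; ring)

theorem QComm.pow_left (hq0 : q ≠ 0) (h : QComm q n a b) (i : ℕ) : QComm q (n * i) (a ^ i) b :=
  (((h.symm hq0).pow_right hq0 i).symm hq0).congr (by ring)

theorem QComm.inv_right (hq0 : q ≠ 0) {v : Rˣ} (h : QComm q n a v) :
    QComm q (-n) a (v⁻¹ : Rˣ) := by
  unfold QComm at *
  have h1 : (v : R) * (a * (v⁻¹ : Rˣ)) = v * (q ^ (-n) • ((v⁻¹ : Rˣ) * a)) := by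
    rw [mul_smul_comm, Units.mul_inv_cancel_left, zpow_neg, eq_inv_smul_iff₀ (zpow_ne_zero _ hq0),
      ← mul_assoc, ← smul_mul_assoc, ← h, Units.mul_inv_cancel_right]
  exact v.isUnit.mul_left_cancel h1

theorem QComm.zpow_right (hq0 : q ≠ 0) {v : Rˣ} (h : QComm q n a v) (i : ℤ) :
    QComm q (n * i) a (v ^ i : Rˣ) := by
  cases i with
  | ofNat i => simpa using h.pow_right hq0 i
  | negSucc i =>
    have := (h.inv_right hq0).pow_right hq0 (i + 1)
    rw [← Units.val_pow_eq_pow_val, inv_pow, ← zpow_natCast, ← zpow_neg] at this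
    exact_mod_cast this.congr (by rw [Int.negSucc_eq]; push_cast; ring)

theorem QComm.zpow_left (hq0 : q ≠ 0) {v : Rˣ} (h : QComm q n (v : R) a) (i : ℤ) :
    QComm q (n * i) ((v ^ i : Rˣ) : R) a :=
  (((h.symm hq0).zpow_right hq0 i).symm hq0).congr (by ring)

theorem QComm.sim (h : QComm q n a b) : QSim q (a * b) (b * a) := ⟨n, h⟩

theorem QComm.map {S : Type*} [Ring S] [Algebra k S] (f : R →ₐ[k] S) (h : QComm q n a b) :
    QComm q n (f a) (f b) := by
  unfold QComm at *
  rw [← map_mul, h, map_smul, map_mul]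

theorem QSim.refl (a : R) : QSim q a a := ⟨0, by simp⟩

theorem QSim.symm (hq0 : q ≠ 0) (h : QSim q a b) : QSim q b a := by
  obtain ⟨e, rfl⟩ := h
  exact ⟨-e, by rw [smul_smul, ← zpow_add₀ hq0]; simp⟩

theorem QSim.trans (hq0 : q ≠ 0) (h : QSim q a b) (h' : QSim q b c) : QSim q a c := by
  obtain ⟨e, rfl⟩ := h
  obtain ⟨f, rfl⟩ := h'
  exact ⟨e + f, by rw [smul_smul, ← zpow_add₀ hq0]⟩

theorem QSim.mul (hq0 : q ≠ 0) (h : QSim q a b) (h' : QSim q c d) : QSim q (a * c) (b * d) := by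
  obtain ⟨e, rfl⟩ := h
  obtain ⟨f, rfl⟩ := h'
  exact ⟨e + f, by rw [smul_mul_smul_comm, ← zpow_add₀ hq0]⟩

theorem QSim.mul_left (hq0 : q ≠ 0) (a : R) (h : QSim q c d) : QSim q (a * c) (a * d) :=
  (QSim.refl a).mul hq0 h

theorem QSim.mul_right (hq0 : q ≠ 0) (a : R) (h : QSim q c d) : QSim q (c * a) (d * a) :=
  h.mul hq0 (QSim.refl a)

theorem QComm.mul_mul_mul_sim (hq0 : q ≠ 0) (h : QComm q n b c) :
    QSim q ((a * b) * (c * d)) ((a * c) * (b * d)) := by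
  have := (h.sim.mul_left hq0 a).mul_right hq0 d
  simpa only [mul_assoc] using this

theorem QComm.mul_pow_sim (hq0 : q ≠ 0) (h : QComm q n a b) (i : ℕ) :
    QSim q ((a * b) ^ i) (a ^ i * b ^ i) := by
  induction i with
  | zero => simpa using QSim.refl 1
  | succ i ih =>
    rw [pow_succ, pow_succ, pow_succ]
    exact (ih.mul_right hq0 _).trans hq0 (((h.symm hq0).pow_left hq0 i).mul_mul_mul_sim hq0)

theorem zpow_inj_of_not_root (hq0 : q ≠ 0) (hq : ∀ n : ℕ, 0 < n → q ^ n ≠ 1)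
    (h : q ^ m = q ^ n) : m = n := by
  wlog hmn : n ≤ m generalizing m n
  · exact (this h.symm (by omega)).symm
  by_contra hne
  obtain ⟨d, hd⟩ := Int.eq_ofNat_of_zero_le (sub_nonneg.2 hmn)
  refine hq d (by omega) ?_
  rw [← zpow_natCast, ← hd, zpow_sub₀ hq0, h, div_self (zpow_ne_zero _ hq0)]

variable {I : TwoSidedIdeal R}

theorem smul_mem (t : k) (h : a ∈ I) : t • a ∈ I := by
  rw [Algebra.smul_def]
  exact I.mul_mem_left _ _ h

theorem smul_mem_iff {t : k} (ht : t ≠ 0) : t • a ∈ I ↔ a ∈ I :=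
  ⟨fun h => by simpa [smul_smul, ht] using smul_mem t⁻¹ h, smul_mem t⟩

theorem QSim.mem_iff (hq0 : q ≠ 0) (h : QSim q a b) : a ∈ I ↔ b ∈ I := by
  obtain ⟨e, rfl⟩ := h
  exact smul_mem_iff (zpow_ne_zero _ hq0)

theorem mul_unit_mem_iff (v : Rˣ) : a * v ∈ I ↔ a ∈ I :=
  ⟨fun h => by simpa using I.mul_mem_right _ (v⁻¹ : Rˣ) h, I.mul_mem_right _ _⟩

theorem unit_mul_mem_iff (v : Rˣ) : v * a ∈ I ↔ a ∈ I :=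
  ⟨fun h => by simpa using I.mul_mem_left (v⁻¹ : Rˣ) _ h, I.mul_mem_left _ _⟩

/-- Weight components with respect to a `q`-commuting element `v` can be separated inside a
two-sided ideal, at the expense of a power of `v`. -/
theorem exists_weight_component_mem {ι : Type*} (hq0 : q ≠ 0)
    (hq : ∀ n : ℕ, 0 < n → q ^ n ≠ 1) (I : TwoSidedIdeal R) (v : R) (μ : ℤ) (w : ι → ℤ)
    (F : Finset ι) (x : ι → R) (hx : ∀ s ∈ F, QComm q (w s) v (x s)) (hF : ∑ s ∈ F, x s ∈ I) :
    ∃ N : ℕ, ∑ s ∈ F with w s = μ, x s * v ^ N ∈ I := by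
  classical
  induction hc : F.card using Nat.strong_induction_on generalizing F x with
  | _ c ih =>
  by_cases hall : ∀ s ∈ F, w s = μ
  · refine ⟨0, ?_⟩
    rw [Finset.filter_true_of_mem hall]
    simpa using hF
  · push Not at hall
    obtain ⟨t, htF, ht⟩ := hall
    set F' := F.filter (fun s => w s ≠ w t) with hF'
    have hlt : F'.card < c := by
      rw [← hc]
      exact Finset.card_lt_card (Finset.filter_ssubset.2 ⟨t, htF, by simp⟩)
    -- The twisted commutator `v·S - q^(w t) S·v` of the sum `S` annihilates all terms of weight `w
    -- t` and rescales the others, at the price of a factor `v` on the right. The terms of weight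
    -- `μ` survive with the common nonzero factor `q^μ - q^(w t)`.
    have key : ∑ s ∈ F', (q ^ w s - q ^ w t) • (x s * v) ∈ I := by
      have h1 : v * (∑ s ∈ F, x s) - q ^ w t • ((∑ s ∈ F, x s) * v) ∈ I :=
        I.sub_mem (I.mul_mem_left _ _ hF) (smul_mem _ (I.mul_mem_right _ _ hF))
      have h2 : v * (∑ s ∈ F, x s) - q ^ w t • ((∑ s ∈ F, x s) * v)
          = ∑ s ∈ F', (q ^ w s - q ^ w t) • (x s * v) := by
        rw [hF', Finset.sum_filter_of_ne, Finset.mul_sum, Finset.sum_mul, Finset.smul_sum,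
          ← Finset.sum_sub_distrib]
        · refine Finset.sum_congr rfl fun s hs => ?_
          rw [sub_smul, ← (hx s hs : v * x s = _)]
        · intro s _ hne h
          simp [h] at hne
      rwa [h2] at h1
    obtain ⟨N, hN⟩ := ih _ hlt F' (fun s => (q ^ w s - q ^ w t) • (x s * v))
      (fun s hs => by
        have := (hx s (Finset.mem_of_mem_filter s hs)).mul_right hq0 (QComm.refl (q := q) v)
        exact (this.congr (add_zero _)).smul_right _) key rfl
    refine ⟨N + 1, ?_⟩
    have hne : q ^ μ - q ^ w t ≠ 0 := fun h =>
      ht (zpow_inj_of_not_root hq0 hq (sub_eq_zero.1 h)).symm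
    rw [← smul_mem_iff hne, Finset.smul_sum]
    have hset : (F'.filter fun s => w s = μ) = F.filter fun s => w s = μ := by
      ext s
      simp only [hF', Finset.mem_filter]
      constructor
      · rintro ⟨⟨h, -⟩, h'⟩
        exact ⟨h, h'⟩
      · rintro ⟨h, h'⟩
        exact ⟨⟨h, fun h'' => ht (h''.symm.trans h')⟩, h'⟩
    rw [hset] at hN
    convert hN using 1
    refine Finset.sum_congr rfl fun s hs => ?_
    rw [(Finset.mem_filter.1 hs).2, smul_mul_assoc, mul_assoc, pow_succ']

/-- Weight components with respect to a `q`-commuting unit can be separated inside a two-sided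
ideal. -/
theorem weight_component_mem_of_unit {ι : Type*} (hq0 : q ≠ 0)
    (hq : ∀ n : ℕ, 0 < n → q ^ n ≠ 1) (I : TwoSidedIdeal R) (v : Rˣ) (μ : ℤ) (w : ι → ℤ)
    (F : Finset ι) (x : ι → R) (hx : ∀ s ∈ F, QComm q (w s) (v : R) (x s))
    (hF : ∑ s ∈ F, x s ∈ I) : ∑ s ∈ F with w s = μ, x s ∈ I := by
  obtain ⟨N, hN⟩ := exists_weight_component_mem hq0 hq I v μ w F x hx hF
  rwa [← Finset.sum_mul, ← Units.val_pow_eq_pow_val, mul_unit_mem_iff] at hN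

end QCommutation

/-! ### Generic freeness for modules spanned by monomial operators -/

section GenericFreeness

open Polynomial

variable {S V Γ : Type*} [CommRing S] [IsDomain S] [AddCommGroup V] [Module S V]

/-- Dickson's lemma: every upward closed subset of `ℕ^r` is finitely generated. -/
theorem exists_finset_generators_of_upward_closed {r : ℕ} (U : Set (Lex (Fin r → ℕ))) :
    ∃ F : Finset (Lex (Fin r → ℕ)), (↑F ⊆ U) ∧ ∀ α ∈ U, ∃ β ∈ F, ∃ γ, α = γ + β := by
  classical
  let U' : Set (Fin r → ℕ) := {a | toLex a ∈ U}
  have hfin : {a | Minimal (· ∈ U') a}.Finite :=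
    WellQuasiOrderedLE.finite_of_isAntichain (setOfPred_minimal_antichain _)
  refine ⟨hfin.toFinset.map toLex.toEmbedding, ?_, fun α hα => ?_⟩
  · intro β hβ
    simp only [Finset.coe_map, Set.mem_image, Finset.mem_coe, Set.Finite.mem_toFinset] at hβ
    obtain ⟨b, hb, rfl⟩ := hβ
    exact hb.prop
  · obtain ⟨b, hb, hmin⟩ := exists_minimal_le_of_wellFoundedLT (· ∈ U') (ofLex α) hα
    refine ⟨toLex b, by simpa using hmin, toLex (ofLex α - b), ?_⟩
    rw [← toLex_add, tsub_add_cancel_of_le hb, toLex_ofLex]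

/-- A weak form of generic freeness over a commutative domain `S`, for a module which is spanned by
the orbit of a vector under operators multiplying like monomials: up to powers of one nonzero
element of `S`, the generator is not divisible by any non-unit. -/
theorem exists_dvd_pow_of_smul_eq {r : ℕ} (x : Lex (Fin r → ℕ) → Module.End S V)
    (hmul : ∀ γ β, ∃ c : Sˣ, x γ * x β = (c : S) • x (γ + β)) (hone : x 0 = 1)
    (htf : ∀ (c : S) (v : V), c • v = 0 → c = 0 ∨ v = 0) (m : V) (hm : m ≠ 0)
    (hspan : Submodule.span S (Set.range fun α => x α m) = ⊤) :
    ∃ g : S, g ≠ 0 ∧ ∀ (h : S) (v : V), m = h • v → ∃ N : ℕ, h ∣ g ^ N := by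
  classical
  let T : Lex (Fin r → ℕ) → Submodule S V := fun α => Submodule.span S ((fun β => x β m) '' Set.Iio α)
  -- Exponents occurring as leading terms of `S`-linear relations among the `x α m`. As with leading
  -- exponents of an ideal, `U` is stable under translation, so Dickson's lemma applies.
  let U : Set (Lex (Fin r → ℕ)) := {α | ∃ c : S, c ≠ 0 ∧ c • x α m ∈ T α}
  have hshift : ∀ (c : S) (γ α), c • x α m ∈ T α → c • x (γ + α) m ∈ T (γ + α) := by
    intro c γ α h
    have h1 : T α ≤ (T (γ + α)).comap (x γ) := by
      refine Submodule.span_le.2 ?_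
      rintro _ ⟨β, hβ, rfl⟩
      obtain ⟨u, hu⟩ := hmul γ β
      change x γ (x β m) ∈ T (γ + α)
      rw [← Module.End.mul_apply, hu, LinearMap.smul_apply]
      exact Submodule.smul_mem _ _ (Submodule.subset_span ⟨γ + β, add_lt_add_right hβ γ, rfl⟩)
    have h2 := h1 h
    obtain ⟨u, hu⟩ := hmul γ α
    rw [Submodule.mem_comap, map_smul, ← Module.End.mul_apply, hu, LinearMap.smul_apply,
      smul_comm] at h2
    exact (Submodule.smul_mem_iff_of_isUnit _ u.isUnit).1 h2
  obtain ⟨F, hFU, hF⟩ := exists_finset_generators_of_upward_closed U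
  have hc : ∀ β : F, ∃ c : S, c ≠ 0 ∧ c • x β m ∈ T β := fun β => hFU β.2
  choose c hc0 hc using hc
  -- Inverting the finitely many leading coefficients of the generating relations makes every
  -- relation with leading exponent in `U` a rewriting rule.
  let g : S := ∏ β, c β
  have hg0 : g ≠ 0 := Finset.prod_ne_zero_iff.2 fun β _ => hc0 β
  have hg : ∀ α ∈ U, g • x α m ∈ T α := by
    intro α hα
    obtain ⟨β, hβ, γ, rfl⟩ := hF α hα
    obtain ⟨d, hd⟩ : c ⟨β, hβ⟩ ∣ g := Finset.dvd_prod_of_mem c (Finset.mem_univ _)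
    rw [hd, mul_comm, mul_smul]
    exact Submodule.smul_mem _ _ (hshift _ _ _ (hc ⟨β, hβ⟩))
  let W : Submodule S V := Submodule.span S (Set.range fun α : (Uᶜ : Set _) => x α m)
  have hloc : ∀ s : Set V, (∀ v ∈ s, ∃ N : ℕ, g ^ N • v ∈ W) →
      ∀ v ∈ Submodule.span S s, ∃ N : ℕ, g ^ N • v ∈ W := by
    intro s hs v hv
    induction hv using Submodule.span_induction with
    | mem v hv => exact hs v hv
    | zero => exact ⟨0, by simp⟩
    | add v w _ _ hv hw =>
      obtain ⟨N, hN⟩ := hv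
      obtain ⟨N', hN'⟩ := hw
      refine ⟨N + N', ?_⟩
      rw [smul_add]
      refine W.add_mem ?_ ?_
      · rw [pow_add, mul_comm, mul_smul]
        exact W.smul_mem _ hN
      · rw [pow_add, mul_smul]
        exact W.smul_mem _ hN'
    | smul a v _ hv =>
      obtain ⟨N, hN⟩ := hv
      exact ⟨N, by rw [smul_comm]; exact W.smul_mem _ hN⟩
  have hmon : ∀ α, ∃ N : ℕ, g ^ N • x α m ∈ W := by
    intro α
    induction α using WellFoundedLT.induction with
    | _ α ih =>
    by_cases hα : α ∈ U
    · obtain ⟨N, hN⟩ := hloc _ (by rintro _ ⟨β, hβ, rfl⟩; exact ih β hβ) _ (hg α hα)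
      exact ⟨N + 1, by rwa [pow_succ, mul_smul]⟩
    · refine ⟨0, ?_⟩
      rw [pow_zero, one_smul]
      exact Submodule.subset_span ⟨⟨α, hα⟩, rfl⟩
  have hall : ∀ v, ∃ N : ℕ, g ^ N • v ∈ W := by
    intro v
    refine hloc _ ?_ v (hspan ▸ Submodule.mem_top : v ∈ Submodule.span S _)
    rintro _ ⟨α, rfl⟩
    exact hmon α
  -- The largest exponent of a nontrivial relation would belong to `U`.
  have hli : LinearIndependent S fun α : (Uᶜ : Set (Lex (Fin r → ℕ))) => x α m := by
    rw [linearIndependent_iff]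
    intro l hl
    by_contra hne
    have hsupp : l.support.Nonempty := Finsupp.support_nonempty_iff.2 hne
    set α := l.support.max' hsupp with hα
    have hαs : α ∈ l.support := Finset.max'_mem _ _
    refine α.2 ⟨l α, Finsupp.mem_support_iff.1 hαs, ?_⟩
    rw [Finsupp.linearCombination_apply, Finsupp.sum, ← Finset.add_sum_erase _ _ hαs] at hl
    rw [eq_neg_of_add_eq_zero_left hl]
    refine Submodule.neg_mem _ (Submodule.sum_mem _ fun β hβ => Submodule.smul_mem _ _ ?_)
    refine Submodule.subset_span ⟨β, ?_, rfl⟩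
    exact lt_of_le_of_ne (Finset.le_max' _ _ (Finset.mem_of_mem_erase hβ))
      (fun h => Finset.ne_of_mem_erase hβ h)
  have h0U : (0 : Lex (Fin r → ℕ)) ∉ U := by
    rintro ⟨c, hc0, hc⟩
    have hT : T 0 = ⊥ := by
      have : Set.Iio (0 : Lex (Fin r → ℕ)) = ∅ := by
        ext β
        simp only [Set.mem_Iio, Set.mem_empty_iff_false, iff_false, not_lt]
        exact Pi.toLex_monotone (fun i => Nat.zero_le (ofLex β i))
      simp [T, this]
    rw [hT, Submodule.mem_bot, hone] at hc
    exact (htf c m hc).elim hc0 hm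
  refine ⟨g, hg0, fun h v hv => ?_⟩
  obtain ⟨N, hN⟩ := hall v
  obtain ⟨l, hl⟩ := (Finsupp.mem_span_range_iff_exists_finsupp).1 hN
  -- Two expansions of `g^N • m` in the independent family: directly, since `m = x 0 m`, and through
  -- `m = h • v`. The coefficient at `0` gives `g^N = h * l 0`.
  have h1 : Finsupp.single (⟨0, h0U⟩ : (Uᶜ : Set _)) (g ^ N) - h • l = 0 := by
    refine linearIndependent_iff.1 hli _ ?_
    rw [map_sub, map_smul, Finsupp.linearCombination_single, Finsupp.linearCombination_apply, hl,
      hone, Module.End.one_apply, smul_comm, ← hv, sub_self]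
  refine ⟨N, l ⟨0, h0U⟩, ?_⟩
  have := DFunLike.congr_fun h1 ⟨0, h0U⟩
  simpa [sub_eq_zero] using this

end GenericFreeness

/-! ### Algebraicity of operators commuting with an irreducible family -/

section Nullstellensatz

open Polynomial

variable {k V : Type*} [Field k] [AddCommGroup V] [Module k V]

/-- A noncommutative Nullstellensatz: an operator commuting with an irreducible family of operators
that multiply like monomials, up to scalars, is algebraic. -/
theorem exists_aeval_eq_zero_of_irreducible {r : ℕ} (x : Lex (Fin r → ℕ) → Module.End k V)
    (hmul : ∀ γ β, ∃ c : kˣ, x γ * x β = (c : k) • x (γ + β)) (hone : x 0 = 1)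
    (z : Module.End k V) (hz : ∀ α, Commute z (x α)) [Nontrivial V]
    (hirr : ∀ N : Submodule k V, (∀ α, ∀ v ∈ N, x α v ∈ N) → N = ⊥ ∨ N = ⊤) :
    ∃ f : k[X], f ≠ 0 ∧ aeval z f = 0 := by
  classical
  by_contra! hcon
  have hcomm : ∀ (f : k[X]) α, aeval z f * x α = x α * aeval z f := by
    intro f α
    induction f using Polynomial.induction_on' with
    | add f g hf hg => rw [map_add, add_mul, mul_add, hf, hg]
    | monomial n a =>
      rw [aeval_monomial, mul_assoc, ((hz α).pow_left n).eq, ← mul_assoc, ← mul_assoc,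
        Algebra.commutes]
  have hcomm' : ∀ (f : k[X]) α (v : V), aeval z f (x α v) = x α (aeval z f v) :=
    fun f α v => LinearMap.congr_fun (hcomm f α) v
  have hker : ∀ f : k[X], f ≠ 0 → LinearMap.ker (aeval z f) = ⊥ := by
    intro f hf
    refine (hirr _ fun α v hv => ?_).resolve_right fun h => hcon f hf (LinearMap.ker_eq_top.1 h)
    rw [LinearMap.mem_ker] at hv ⊢
    rw [hcomm', hv, map_zero]
  have hrange : ∀ f : k[X], f ≠ 0 → LinearMap.range (aeval z f) = ⊤ := by
    intro f hf
    refine (hirr _ fun α v hv => ?_).resolve_left fun h => hcon f hf (LinearMap.range_eq_bot.1 h)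
    obtain ⟨w, rfl⟩ := hv
    exact ⟨x α w, hcomm' f α w⟩
  -- By Schur's argument every nonzero polynomial in `z` is now bijective, so `V` is torsion-free
  -- and divisible over `k[X]`. Divisibility is what contradicts generic freeness.
  let _ : Module k[X] V := Module.compHom V (aeval z : k[X] →ₐ[k] Module.End k V).toRingHom
  have hsmul : ∀ (f : k[X]) (v : V), f • v = aeval z f v := fun _ _ => rfl
  let x' : Lex (Fin r → ℕ) → Module.End k[X] V := fun α =>
    { toFun := x α
      map_add' := map_add _
      map_smul' := fun f v => (hcomm' f α v).symm }
  obtain ⟨m, hm⟩ := exists_ne (0 : V)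
  have hspan : Submodule.span k (Set.range fun α => x α m) = ⊤ := by
    refine (hirr _ fun α v hv => ?_).resolve_left fun h => hm ?_
    · refine (Submodule.span_le (p := (Submodule.span k (Set.range fun α => x α m)).comap (x α))).2
        ?_ hv
      rintro _ ⟨β, rfl⟩
      obtain ⟨c, hc⟩ := hmul α β
      change x α (x β m) ∈ Submodule.span k (Set.range fun α => x α m)
      rw [← Module.End.mul_apply, hc, LinearMap.smul_apply]
      exact Submodule.smul_mem _ _ (Submodule.subset_span ⟨_, rfl⟩)
    · rw [← Submodule.mem_bot k, ← h]
      exact Submodule.subset_span ⟨0, by simp [hone]⟩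
  obtain ⟨g, hg0, hg⟩ := exists_dvd_pow_of_smul_eq x' (fun γ β => by
      obtain ⟨c, hc⟩ := hmul γ β
      refine ⟨Units.map (C : k →+* k[X]).toMonoidHom c, LinearMap.ext fun v => ?_⟩
      have := LinearMap.congr_fun hc v
      change x γ (x β v) = aeval z (C (c : k)) (x (γ + β) v)
      rw [aeval_C]
      exact this)
    (LinearMap.ext fun v => LinearMap.congr_fun hone v)
    (fun c v h => by
      refine or_iff_not_imp_left.2 fun hc => ?_
      rw [← Submodule.mem_bot k, ← hker c hc]
      exact h) m hm
    (by
      refine eq_top_iff.2 fun v _ => ?_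
      have hv : v ∈ Submodule.span k (Set.range fun α => x α m) := hspan ▸ Submodule.mem_top
      induction hv using Submodule.span_induction with
      | mem v hv => exact Submodule.subset_span hv
      | zero => exact Submodule.zero_mem _
      | add v w _ _ hv hw => exact Submodule.add_mem _ (hv trivial) (hw trivial)
      | smul a v _ hv =>
        have : a • v = (C a : k[X]) • v := by rw [hsmul, aeval_C]; rfl
        rw [this]
        exact Submodule.smul_mem _ _ (hv trivial))
  -- `X * g + 1` is coprime to `g` and not a unit, hence divides no power of `g`; yet `m` is
  -- divisible by it. This explicit choice works over finite fields as well.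
  have hne : (Polynomial.X * g + 1 : k[X]) ≠ 0 := by
    intro h
    have := congrArg (eval 0) h
    simp at this
  obtain ⟨v, hv⟩ : m ∈ LinearMap.range (aeval z (Polynomial.X * g + 1)) := hrange _ hne ▸ Submodule.mem_top
  obtain ⟨N, hN⟩ := hg (Polynomial.X * g + 1) v hv.symm
  have hcop : IsCoprime (Polynomial.X * g + 1 : k[X]) (g ^ N) :=
    IsCoprime.pow_right ⟨1, -Polynomial.X, by ring⟩
  have hunit := hcop.isUnit_of_dvd' dvd_rfl hN
  have hdeg := natDegree_eq_zero_of_isUnit hunit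
  rw [← C_1, natDegree_add_C, natDegree_X_mul hg0] at hdeg
  omega

end Nullstellensatz

/-! ### Defining relations, the normal element `φ`, and the universal property -/

section Relations

/-- The elements `e`, `x`, `y` and the unit `v` satisfy the defining relations of the quantum
spatial ageing algebra for `E`, `X`, `Y` and `K`. -/
structure IsAgeing {k R : Type*} [Field k] [Ring R] [Algebra k R] (q : k) (e x y : R) (v : Rˣ) :
    Prop where
  e_v : QComm q (-2) e (v : R)
  x_v : QComm q (-1) x (v : R)
  y_v : QComm q 1 y (v : R)
  e_x : QComm q 1 e x
  x_y : QComm q 1 x y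
  e_mul_y : e * y = x + q⁻¹ • (y * e)

section General

variable {k R : Type*} [Field k] [Ring R] [Algebra k R]

/-- The element `φ` expressed through `X` and `YE`. -/
def phiOf (q : k) (e x y : R) : R := x + (q⁻¹ - q) • (y * e)

variable {q : k} {e x y : R} {v : Rˣ}

namespace IsAgeing

theorem phi_v (h : IsAgeing q e x y v) (hq0 : q ≠ 0) : QComm q (-1) (phiOf q e x y) (v : R) := by
  have h1 : QComm q (-1) (y * e) (v : R) := h.y_v.mul_left hq0 h.e_v
  have h2 := h.x_v
  unfold QComm at *
  rw [phiOf, add_mul, h2, smul_mul_assoc, h1, mul_add, smul_add, mul_smul_comm, smul_comm]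

theorem phi_x (h : IsAgeing q e x y v) (hq0 : q ≠ 0) : QComm q 0 (phiOf q e x y) x := by
  have h1 : QComm q 0 (y * e) x := (h.x_y.symm hq0).mul_left hq0 h.e_x
  unfold QComm at *
  rw [zpow_zero, one_smul] at *
  rw [phiOf, add_mul, smul_mul_assoc, h1, mul_add, mul_smul_comm]

/-- The extra `X` produced by `EY` changes the coefficient `q` of `XE` into `q + (q⁻¹ - q) = q⁻¹`,
which agrees with the factor `q⁻¹` on the `YE` term. This is why `φ` has the coefficient `q⁻¹ - q`.
-/
theorem e_phi (h : IsAgeing q e x y v) : QComm q (-1) e (phiOf q e x y) := by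
  have h1 := h.e_x
  unfold QComm at *
  rw [phiOf, mul_add, mul_smul_comm, ← mul_assoc, h.e_mul_y, h1, add_mul, add_mul, smul_add,
    smul_add]
  simp only [smul_mul_assoc, smul_smul, mul_assoc]
  rw [← add_assoc, ← add_smul]
  congr 2
  · rw [zpow_neg_one, zpow_one]; ring
  · rw [zpow_neg_one]; ring

theorem phi_y (h : IsAgeing q e x y v) : QComm q (-1) (phiOf q e x y) y := by
  have h1 := h.x_y
  unfold QComm at *
  rw [phiOf, add_mul, smul_mul_assoc, mul_assoc y, h.e_mul_y, h1, mul_add, mul_add, smul_add,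
    smul_add]
  simp only [mul_smul_comm, smul_smul, ← mul_assoc]
  rw [← add_assoc, ← add_smul]
  congr 2
  · rw [zpow_neg_one, zpow_one]; ring
  · rw [zpow_neg_one]; ring

theorem map {S : Type*} [Ring S] [Algebra k S] (f : R →ₐ[k] S) (h : IsAgeing q e x y v) :
    IsAgeing q (f e) (f x) (f y) (Units.map (f : R →* S) v) where
  e_v := h.e_v.map f
  x_v := h.x_v.map f
  y_v := h.y_v.map f
  e_x := h.e_x.map f
  x_y := h.x_y.map f
  e_mul_y := by rw [← map_mul, h.e_mul_y, map_add, map_smul, map_mul]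

end IsAgeing

theorem map_phiOf {S : Type*} [Ring S] [Algebra k S] (f : R →ₐ[k] S) :
    f (phiOf q e x y) = phiOf q (f e) (f x) (f y) := by
  rw [phiOf, phiOf, map_add, map_smul, map_mul]

end General

variable {k : Type u} [Field k] (q : k)

theorem gen_K_mul_Kinv : gen q .K * gen q .Kinv = 1 := by
  simpa [gen] using RingQuot.mkAlgHom_rel k (Rel.K_mul_Kinv (q := q))

theorem gen_Kinv_mul_K : gen q .Kinv * gen q .K = 1 := by
  simpa [gen] using RingQuot.mkAlgHom_rel k (Rel.Kinv_mul_K (q := q))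

/-- The element `K`, as a unit. -/
def K : (Alg q)ˣ := ⟨gen q .K, gen q .Kinv, gen_K_mul_Kinv q, gen_Kinv_mul_K q⟩

theorem isAgeing_alg : IsAgeing q (E q) (X q) (Y q) (K q) where
  e_v := by
    have := RingQuot.mkAlgHom_rel k (Rel.E_mul_K (q := q))
    rwa [map_smul, map_mul, map_mul, ← zpow_natCast, ← zpow_neg] at this
  x_v := by
    have := RingQuot.mkAlgHom_rel k (Rel.X_mul_K (q := q))
    rwa [map_smul, map_mul, map_mul, ← zpow_neg_one] at this
  y_v := by
    have := RingQuot.mkAlgHom_rel k (Rel.Y_mul_K (q := q))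
    rw [map_smul, map_mul, map_mul] at this
    unfold QComm
    rw [zpow_one]
    exact this
  e_x := by
    have := RingQuot.mkAlgHom_rel k (Rel.E_mul_X (q := q))
    rw [map_smul, map_mul, map_mul] at this
    unfold QComm
    rw [zpow_one]
    exact this
  x_y := by
    have := RingQuot.mkAlgHom_rel k (Rel.Y_mul_X (q := q))
    rw [map_smul, map_mul, map_mul] at this
    unfold QComm
    rw [zpow_one]
    exact this.symm
  e_mul_y := by
    have := RingQuot.mkAlgHom_rel k (Rel.E_mul_Y (q := q))
    rw [map_add, map_smul, map_mul, map_mul] at this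
    exact this

theorem phi_eq : phi q = phiOf q (E q) (X q) (Y q) := by
  have h : ∀ {R : Type u} [Ring R] [Algebra k R] {e x y : R}, e * y = x + q⁻¹ • (y * e) →
      e * y - q • (y * e) = phiOf q e x y := by
    intro R _ _ e x y h
    rw [phiOf, h, sub_smul]
    abel
  exact h (isAgeing_alg q).e_mul_y

variable {q}

/-- A subspace containing `1` and stable under left multiplication by `E`, `Y` and `K`, `K⁻¹` is
everything. -/
theorem submodule_eq_top_of_mul_mem (S : Submodule k (Alg q)) (h1 : 1 ∈ S)
    (hE : ∀ a ∈ S, E q * a ∈ S) (hY : ∀ a ∈ S, Y q * a ∈ S) (hK : ∀ a ∈ S, (K q : Alg q) * a ∈ S)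
    (hK' : ∀ a ∈ S, ((K q)⁻¹ : (Alg q)ˣ) * a ∈ S) : S = ⊤ := by
  let B : Subalgebra k (Alg q) :=
    { carrier := {b | ∀ a ∈ S, b * a ∈ S}
      mul_mem' := fun {b c} hb hc a ha => by rw [mul_assoc]; exact hb _ (hc _ ha)
      add_mem' := fun {b c} hb hc a ha => by rw [add_mul]; exact S.add_mem (hb _ ha) (hc _ ha)
      algebraMap_mem' := fun t a ha => by rw [← Algebra.smul_def]; exact S.smul_mem _ ha }
  -- `X = EY - q⁻¹YE`, so `X` is redundant as a generator.
  have hX : X q ∈ B := by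
    rw [eq_sub_of_add_eq (isAgeing_alg q).e_mul_y.symm]
    exact B.sub_mem (B.mul_mem hE hY) (B.smul_mem (B.mul_mem hY hE) _)
  have hB : B.comap (RingQuot.mkAlgHom k (Rel q)) = ⊤ := by
    rw [eq_top_iff, ← FreeAlgebra.adjoin_range_ι]
    refine Algebra.adjoin_le ?_
    rintro _ ⟨g, rfl⟩
    cases g
    exacts [hE, hK, hK', hX, hY]
  refine eq_top_iff.2 fun a _ => ?_
  obtain ⟨a, rfl⟩ := RingQuot.mkAlgHom_surjective k (Rel q) a
  have : a ∈ B.comap (RingQuot.mkAlgHom k (Rel q)) := hB ▸ Algebra.mem_top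
  have h2 : RingQuot.mkAlgHom k (Rel q) a * 1 ∈ S := this 1 h1
  rwa [mul_one] at h2

/-- The universal property of the quantum spatial ageing algebra. -/
theorem exists_algHom {R : Type*} [Ring R] [Algebra k R] {e x y : R} {v : Rˣ}
    (h : IsAgeing q e x y v) :
    ∃ ρ : Alg q →ₐ[k] R, ρ (E q) = e ∧ ρ (X q) = x ∧ ρ (Y q) = y ∧ ρ (K q) = v := by
  let f : Gen → R := fun g => match g with
    | .E => e | .K => v | .Kinv => (v⁻¹ : Rˣ) | .X => x | .Y => y
  have hf : ∀ ⦃a b : FreeAlgebra k Gen⦄, Rel q a b →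
      FreeAlgebra.lift k f a = FreeAlgebra.lift k f b := by
    intro a b hab
    obtain ⟨h1, h2, h3, h4, h5, h6⟩ := h
    unfold QComm at *
    rw [zpow_one] at h3 h4 h5
    cases hab <;>
      simp only [map_mul, map_smul, map_add, map_one, free, FreeAlgebra.lift_ι_apply, f]
    · simp
    · simp
    · rw [zpow_neg] at h1
      exact_mod_cast h1
    · rw [zpow_neg_one] at h2
      exact h2
    · exact h3
    · exact h4
    · exact h6
    · exact h5.symm
  refine ⟨RingQuot.liftAlgHom k ⟨FreeAlgebra.lift k f, hf⟩, ?_⟩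
  refine ⟨?_, ?_, ?_, ?_⟩ <;>
    exact (RingQuot.liftAlgHom_mkAlgHom_apply _ _ _ _).trans (FreeAlgebra.lift_ι_apply _ _)

/-- Two-sided ideals correspond along surjective homomorphisms. -/
theorem exists_twoSidedIdeal_map {A R : Type*} [Ring A] [Ring R] (π : A →+* R)
    (hπ : Function.Surjective π) (I : TwoSidedIdeal A) (hI : ∀ a, π a = 0 → a ∈ I) :
    ∃ J : TwoSidedIdeal R, ∀ a, π a ∈ J ↔ a ∈ I := by
  have key : ∀ a b, π a = π b → (a ∈ I ↔ b ∈ I) := by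
    intro a b hab
    have h := hI (a - b) (by rw [map_sub, hab, sub_self])
    exact ⟨fun ha => by simpa using I.sub_mem ha h, fun hb => by simpa using I.add_mem h hb⟩
  refine ⟨TwoSidedIdeal.mk' (π '' I) ⟨0, I.zero_mem, map_zero π⟩ ?_ ?_ ?_ ?_, fun a => ?_⟩
  · rintro _ _ ⟨a, ha, rfl⟩ ⟨b, hb, rfl⟩
    exact ⟨a + b, I.add_mem ha hb, map_add π a b⟩
  · rintro _ ⟨a, ha, rfl⟩
    exact ⟨-a, I.neg_mem ha, map_neg π a⟩
  · rintro r _ ⟨b, hb, rfl⟩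
    obtain ⟨a, rfl⟩ := hπ r
    exact ⟨a * b, I.mul_mem_left _ _ hb, map_mul π a b⟩
  · rintro _ r ⟨a, ha, rfl⟩
    obtain ⟨b, rfl⟩ := hπ r
    exact ⟨a * b, I.mul_mem_right _ _ ha, map_mul π a b⟩
  · refine (TwoSidedIdeal.mem_mk' _ _ _ _ _ _ _).trans ⟨?_, ?_⟩
    · rintro ⟨b, hb, hab⟩
      exact (key b a hab).1 hb
    · exact fun ha => ⟨a, ha, rfl⟩

/-- Every two-sided ideal is the kernel of a surjective algebra homomorphism. -/
theorem exists_algHom_ker {A : Type u} [Ring A] [Algebra k A] (P : TwoSidedIdeal A) :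
    ∃ (R : Type u) (_ : Ring R) (_ : Algebra k R) (π : A →ₐ[k] R), Function.Surjective π ∧
      ∀ a, π a = 0 ↔ a ∈ P := by
  refine ⟨P.ringCon.Quotient, inferInstance, inferInstance,
    { P.ringCon.mk' with commutes' := fun _ => rfl }, P.ringCon.mk'_surjective, fun a => ?_⟩
  rw [TwoSidedIdeal.mem_iff]
  exact P.ringCon.eq

end Relations

/-! ### Ideals in a quantum plane with one invertible generator -/

section QuantumPlane

variable {k R : Type*} [Field k] [Ring R] [Algebra k R] {q : k} {g : R} {v : Rˣ} {d : ℤ}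

/-- In a ring where `g v = q^d v g`, a two-sided ideal containing a nonzero polynomial in `v`, `g`
contains a power of `g`. -/
theorem exists_pow_mem_of_sum_mem (hq0 : q ≠ 0) (hq : ∀ n : ℕ, 0 < n → q ^ n ≠ 1) (hd : d ≠ 0)
    (h : QComm q d g (v : R)) (J : TwoSidedIdeal R) (c : ℤ × ℕ →₀ k) (hc : c ≠ 0)
    (hJ : c.sum (fun s t => t • ((v ^ s.1 : Rˣ) * g ^ s.2 : R)) ∈ J) : ∃ j : ℕ, g ^ j ∈ J := by
  classical
  obtain ⟨s₀, hs₀⟩ := Finsupp.support_nonempty_iff.2 hc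
  -- Commuting with `v` detects the exponent of `g`, commuting with `g` that of `v`; since `d ≠ 0`,
  -- the two weights together isolate a single monomial.
  have h1 := weight_component_mem_of_unit hq0 hq J v (-d * s₀.2) (fun s => -d * s.2)
    c.support (fun s => c s • ((v ^ s.1 : Rˣ) * g ^ s.2 : R)) (fun s _ => by
      refine QComm.smul_right ?_ _
      have h1 := (QComm.refl (q := q) (v : R)).zpow_right hq0 s.1
      have h2 := (h.symm hq0).pow_right hq0 s.2
      exact (h1.mul_right hq0 h2).congr (by ring)) hJ
  obtain ⟨N, hN⟩ := exists_weight_component_mem hq0 hq J g (d * s₀.1) (fun s => d * s.1)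
    _ (fun s => c s • ((v ^ s.1 : Rˣ) * g ^ s.2 : R)) (fun s _ => by
      refine QComm.smul_right ?_ _
      have h1 := h.zpow_right hq0 s.1
      have h2 := (QComm.refl (q := q) g).pow_right hq0 s.2
      exact (h1.mul_right hq0 h2).congr (by ring)) h1
  rw [Finset.sum_eq_single_of_mem s₀] at hN
  · rw [smul_mul_assoc, smul_mem_iff (Finsupp.mem_support_iff.1 hs₀), mul_assoc, ← pow_add,
      unit_mul_mem_iff] at hN
    exact ⟨_, hN⟩
  · simp [hs₀]
  · intro s hs hne
    simp only [Finset.mem_filter, mul_eq_mul_left_iff, neg_eq_zero, hd, or_false,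
      Nat.cast_inj] at hs
    exact absurd (Prod.ext hs.2 hs.1.2) hne

end QuantumPlane

/-! ### The quantum spaces modulo `X` and modulo `φ`, and their central element -/

section QuantumSpace

open Polynomial

/-- The relations of a quantum affine space in `E`, `Y` with a unit `K`, satisfied in the quotients
of the quantum spatial ageing algebra by `X` (for `ε = -1`) and by `φ` (for `ε = 1`). -/
structure IsQuantumSpace {k R : Type*} [Field k] [Ring R] [Algebra k R] (q : k) (ε : ℤ) (e y : R)
    (v : Rˣ) : Prop where
  e_v : QComm q (-2) e (v : R)
  y_v : QComm q 1 y (v : R)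
  e_y : QComm q ε e y

variable {k R : Type*} [Field k] [Ring R] [Algebra k R] {q : k} {e y : R} {v : Rˣ} {ε : ℤ}

/-- The central element `K^ε Y² E`. -/
def zOf (ε : ℤ) (e y : R) (v : Rˣ) : R := (v ^ ε : Rˣ) * (y ^ 2 * e)

/-- The monomial `K^n Y^b E^a`. -/
def monomialOf (e y : R) (v : Rˣ) (s : ℤ × ℕ × ℕ) : R := (v ^ s.1 : Rˣ) * (y ^ s.2.1 * e ^ s.2.2)

/-- The weight of the monomial `K^n Y^b E^a` under conjugation by `K` and `Y`. -/
def weightOf (ε : ℤ) (s : ℤ × ℕ × ℕ) : ℤ × ℤ := (s.2.1 - 2 * s.2.2, s.1 - ε * s.2.2)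

namespace IsQuantumSpace

theorem v_z (h : IsQuantumSpace q ε e y v) (hq0 : q ≠ 0) : QComm q 0 (v : R) (zOf ε e y v) :=
  (((QComm.refl (v : R)).zpow_right hq0 ε).mul_right hq0
    (((h.y_v.symm hq0).pow_right hq0 2).mul_right hq0 (h.e_v.symm hq0))).congr (by norm_num)

theorem y_z (h : IsQuantumSpace q ε e y v) (hq0 : q ≠ 0) : QComm q 0 y (zOf ε e y v) :=
  ((h.y_v.zpow_right hq0 ε).mul_right hq0
    (((QComm.refl y).pow_right hq0 2).mul_right hq0 (h.e_y.symm hq0))).congr (by ring)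

theorem e_z (h : IsQuantumSpace q ε e y v) (hq0 : q ≠ 0) : QComm q 0 e (zOf ε e y v) :=
  ((h.e_v.zpow_right hq0 ε).mul_right hq0
    ((h.e_y.pow_right hq0 2).mul_right hq0 (QComm.refl e))).congr (by push_cast; ring)

theorem z_pow_sim (h : IsQuantumSpace q ε e y v) (hq0 : q ≠ 0) (a : ℕ) :
    QSim q (zOf ε e y v ^ a) ((v ^ (ε * a) : Rˣ) * (y ^ (2 * a) * e ^ a)) := by
  have h1 : QComm q (-ε) y e := h.e_y.symm hq0
  have h2 : QComm q _ (y ^ 2 * e) (v ^ ε : Rˣ) :=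
    ((h.y_v.pow_left hq0 2).mul_left hq0 h.e_v).zpow_right hq0 ε
  have h3 := (h2.symm hq0).mul_pow_sim hq0 a
  have h4 := (h1.pow_left hq0 2).mul_pow_sim hq0 a
  rw [← Units.val_pow_eq_pow_val, ← zpow_natCast, ← zpow_mul] at h3
  rw [← pow_mul] at h4
  exact h3.trans hq0 (h4.mul_left hq0 _)

theorem v_monomial (h : IsQuantumSpace q ε e y v) (hq0 : q ≠ 0) (s : ℤ × ℕ × ℕ) :
    QComm q (-(weightOf ε s).1) (v : R) (monomialOf e y v s) :=
  (((QComm.refl (v : R)).zpow_right hq0 s.1).mul_right hq0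
    (((h.y_v.symm hq0).pow_right hq0 s.2.1).mul_right hq0
      ((h.e_v.symm hq0).pow_right hq0 s.2.2))).congr (by simp only [weightOf]; ring)

theorem y_monomial (h : IsQuantumSpace q ε e y v) (hq0 : q ≠ 0) (s : ℤ × ℕ × ℕ) :
    QComm q (weightOf ε s).2 y (monomialOf e y v s) :=
  ((h.y_v.zpow_right hq0 s.1).mul_right hq0
    (((QComm.refl y).pow_right hq0 s.2.1).mul_right hq0
      ((h.e_y.symm hq0).pow_right hq0 s.2.2))).congr (by simp only [weightOf]; ring)

/-- Cancelling `K^(n - εa)` from `KⁿY^bE^a` leaves `K^(εa)Y^bE^a`. Since `b + N = d + 2a`, the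
factors `K^(εa)`, `Y^(2a)`, `E^a` reassemble into `z^a`, leaving `Y^d`. -/
theorem monomial_mul_sim (h : IsQuantumSpace q ε e y v) (hq0 : q ≠ 0) {d N : ℕ} {s : ℤ × ℕ × ℕ}
    (hd : (d : ℤ) = (weightOf ε s).1 + N) :
    QSim q ((v ^ (-(weightOf ε s).2) : Rˣ) * monomialOf e y v s * y ^ N)
      (y ^ d * zOf ε e y v ^ s.2.2) := by
  obtain ⟨n, b, a⟩ := s
  simp only [weightOf, monomialOf] at *
  have h1 : ((v ^ (-(n - ε * a)) : Rˣ) * ((v ^ n : Rˣ) * (y ^ b * e ^ a)) * y ^ N : R)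
      = (v ^ (ε * a) : Rˣ) * (y ^ b * (e ^ a * y ^ N)) := by
    rw [← mul_assoc, ← Units.val_mul, ← zpow_add, mul_assoc, mul_assoc]
    congr 4
    ring
  rw [h1]
  have h2 : QSim q ((v ^ (ε * a) : Rˣ) * (y ^ b * (e ^ a * y ^ N)) : R)
      ((v ^ (ε * a) : Rˣ) * (y ^ b * (y ^ N * e ^ a))) :=
    ((((h.e_y.pow_left hq0 a).pow_right hq0 N).sim).mul_left hq0 _).mul_left hq0 _
  have h3 : QSim q (y ^ d * zOf ε e y v ^ a)
      (y ^ d * ((v ^ (ε * a) : Rˣ) * (y ^ (2 * a) * e ^ a))) :=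
    (h.z_pow_sim hq0 a).mul_left hq0 _
  have h4 : QSim q (y ^ d * ((v ^ (ε * a) : Rˣ) * (y ^ (2 * a) * e ^ a)))
      ((v ^ (ε * a) : Rˣ) * y ^ d * (y ^ (2 * a) * e ^ a)) := by
    rw [← mul_assoc]
    exact (((h.y_v.pow_left hq0 d).zpow_right hq0 (ε * a)).sim).mul_right hq0 _
  refine h2.trans hq0 ((h3.trans hq0 h4).symm hq0 |> fun h5 => ?_)
  have h6 : ((v ^ (ε * a) : Rˣ) * (y ^ b * (y ^ N * e ^ a)) : R)
      = (v ^ (ε * a) : Rˣ) * y ^ d * (y ^ (2 * a) * e ^ a) := by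
    have : b + N = d + 2 * a := by omega
    rw [mul_assoc (v ^ (ε * a) : Rˣ).val, ← mul_assoc (y ^ b), ← pow_add, ← mul_assoc (y ^ d),
      ← pow_add, this]
  rw [h6]
  exact h5

/-- Each weight component of an element of a two-sided ideal of a quantum space is, up to units and
powers of `Y`, a polynomial in the central element, and that polynomial times a power of `Y` lies
in the ideal. -/
theorem exists_polynomial (h : IsQuantumSpace q ε e y v) (hq0 : q ≠ 0)
    (hq : ∀ n : ℕ, 0 < n → q ^ n ≠ 1) (J : TwoSidedIdeal R) (c : ℤ × ℕ × ℕ →₀ k)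
    (hJ : c.sum (fun s t => t • monomialOf e y v s) ∈ J) (μ : ℤ × ℤ) :
    ∃ (f : k[X]) (d N : ℕ) (n : ℤ),
      (v ^ n : Rˣ) * (∑ s ∈ c.support with weightOf ε s = μ, c s • monomialOf e y v s) * y ^ N
        = y ^ d * aeval (zOf ε e y v) f ∧
      ((∃ s ∈ c.support, weightOf ε s = μ) → f ≠ 0) ∧ y ^ d * aeval (zOf ε e y v) f ∈ J := by
  classical
  have h1 := weight_component_mem_of_unit hq0 hq J v (-μ.1) (fun s => -(weightOf ε s).1)
    c.support (fun s => c s • monomialOf e y v s)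
    (fun s _ => (h.v_monomial hq0 s).smul_right _) hJ
  obtain ⟨N₁, hN₁⟩ := exists_weight_component_mem hq0 hq J y μ.2 (fun s => (weightOf ε s).2)
    _ (fun s => c s • monomialOf e y v s) (fun s _ => (h.y_monomial hq0 s).smul_right _) h1
  have hset : ((c.support.filter fun s => -(weightOf ε s).1 = -μ.1).filter
      fun s => (weightOf ε s).2 = μ.2) = c.support.filter fun s => weightOf ε s = μ := by
    ext s
    simp only [Finset.mem_filter, neg_inj, Prod.ext_iff, and_assoc]
  rw [hset, ← Finset.sum_mul] at hN₁
  set F := c.support.filter fun s => weightOf ε s = μ with hF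
  -- `N₁` is the cost of separating `Y`-weights. The second summand makes `μ.1 + N` nonnegative, so
  -- that `d` really equals it despite the truncation by `toNat`.
  let N := N₁ + (-μ.1).toNat
  let d := (μ.1 + N).toNat
  have hd : (d : ℤ) = μ.1 + N := by simp only [d, N]; omega
  have hsim : ∀ s : ℤ × ℕ × ℕ, ∃ i : ℤ, weightOf ε s = μ →
      (v ^ (-μ.2) : Rˣ) * monomialOf e y v s * y ^ N
        = q ^ i • (y ^ d * zOf ε e y v ^ s.2.2) := by
    intro s
    by_cases hs : weightOf ε s = μ
    · obtain ⟨i, hi⟩ := h.monomial_mul_sim hq0 (s := s) (d := d) (N := N) (by rw [hs, hd])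
      exact ⟨i, fun _ => by rw [← hi, hs]⟩
    · exact ⟨0, fun h => absurd h hs⟩
  choose i hi using hsim
  let f : k[X] := ∑ s ∈ F, Polynomial.monomial s.2.2 (c s * q ^ i s)
  have hf : (v ^ (-μ.2) : Rˣ) * (∑ s ∈ F, c s • monomialOf e y v s) * y ^ N
      = y ^ d * aeval (zOf ε e y v) f := by
    simp only [f]
    rw [map_sum, Finset.mul_sum, Finset.mul_sum, Finset.sum_mul]
    refine Finset.sum_congr rfl fun s hs => ?_
    rw [mul_smul_comm, smul_mul_assoc, hi s (Finset.mem_filter.1 hs).2, aeval_monomial,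
      ← Algebra.smul_def, mul_smul_comm, smul_smul]
  refine ⟨f, d, N, -μ.2, hf, ?_, ?_⟩
  · rintro ⟨s₀, hs₀, hμ⟩ hf0
    -- Within a fixed weight the exponent of `E` determines those of `Y` and `K`, so distinct
    -- monomials give distinct powers of `z` and nothing cancels.
    have hcoeff : f.coeff s₀.2.2 = c s₀ * q ^ i s₀ := by
      simp only [f]
      rw [finsetSum_coeff, Finset.sum_eq_single_of_mem s₀ (Finset.mem_filter.2 ⟨hs₀, hμ⟩)]
      · simp
      · intro s hs hne
        rw [coeff_monomial, if_neg]
        intro ha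
        apply hne
        have := (Finset.mem_filter.1 hs).2.trans hμ.symm
        simp only [weightOf, Prod.mk.injEq, ha] at this
        obtain ⟨hb, hn⟩ := this
        exact Prod.ext (by linarith) (Prod.ext (by omega) ha)
    rw [hf0, coeff_zero] at hcoeff
    exact mul_ne_zero (Finsupp.mem_support_iff.1 hs₀) (zpow_ne_zero _ hq0) hcoeff.symm
  · rw [← hf, show N = N₁ + (-μ.1).toNat from rfl, pow_add, ← mul_assoc, mul_assoc (v ^ _ : Rˣ).val]
    exact J.mul_mem_right _ _ (J.mul_mem_left _ _ hN₁)

end IsQuantumSpace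

end QuantumSpace

/-! ### Monomials in `K`, `Y` or `E`, `X`, `φ`, and reduction to powers of `X` and `φ` -/

section Ageing

variable {k R : Type*} [Field k] [Ring R] [Algebra k R] {q : k} {e x y : R} {v : Rˣ}

/-- The element `Y^m` for `m ≥ 0` and `E^(-m)` for `m ≤ 0`. -/
def yePow (e y : R) (m : ℤ) : R := y ^ m.toNat * e ^ (-m).toNat

/-- The element `K^n Y^m X^i φ^j`, where `Y^m` means `E^(-m)` for negative `m`. -/
def ageingMonomial (q : k) (e x y : R) (v : Rˣ) (s : (ℤ × ℤ) × (ℕ × ℕ)) : R :=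
  (v ^ s.1.1 : Rˣ) * (yePow e y s.1.2 * (x ^ s.2.1 * phiOf q e x y ^ s.2.2))

theorem yePow_of_nat (b : ℕ) : yePow e y b = y ^ b := by simp [yePow]

theorem yePow_neg_of_nat (a : ℕ) : yePow e y (-a) = e ^ a := by simp [yePow]

theorem QComm.yePow_right (hq0 : q ≠ 0) {g : R} {n m : ℤ} (hy : QComm q n g y) (he : QComm q (-n) g e) (hn : m = n)
    (i : ℤ) : QComm q (m * i) g (yePow e y i) :=
  ((hy.pow_right hq0 _).mul_right hq0 (he.pow_right hq0 _)).congr (by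
    have : ((i.toNat : ℕ) : ℤ) - ((-i).toNat : ℕ) = i := by omega
    rw [hn]
    linear_combination n * this)

theorem QComm.x_pow_mul_phi_pow_right (hq0 : q ≠ 0) {g : R} {m n : ℤ} (hx : QComm q m g x) (hp : QComm q n g (phiOf q e x y))
    (i j : ℕ) : QComm q (m * i + n * j) g (x ^ i * phiOf q e x y ^ j) :=
  (hx.pow_right hq0 i).mul_right hq0 (hp.pow_right hq0 j)

theorem inv_sub_ne_zero (hq0 : q ≠ 0) (hq : ∀ n : ℕ, 0 < n → q ^ n ≠ 1) : q⁻¹ - q ≠ 0 := by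
  intro h
  refine hq 2 two_pos ?_
  rw [sub_eq_zero] at h
  rw [pow_two]
  nth_rewrite 1 [← h]
  exact inv_mul_cancel₀ hq0

namespace IsAgeing

theorem smul_y_mul_e : (q⁻¹ - q) • (y * e) = phiOf q e x y - x := by
  rw [phiOf, add_sub_cancel_left]

theorem smul_e_mul_y (h : IsAgeing q e x y v) :
    (q⁻¹ - q) • (e * y) = q⁻¹ • phiOf q e x y - q • x := by
  rw [h.e_mul_y, phiOf, smul_add, smul_add, smul_smul, smul_smul, mul_comm, sub_smul, mul_comm]
  abel

variable (h : IsAgeing q e x y v) (hq0 : q ≠ 0)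
include h hq0

theorem commute_x_phi : Commute x (phiOf q e x y) := by
  have := h.phi_x hq0
  unfold QComm at this
  rw [zpow_zero, one_smul] at this
  exact this.symm

theorem x_monomial (s : (ℤ × ℤ) × (ℕ × ℕ)) :
    QComm q (s.1.2 - s.1.1) x (ageingMonomial q e x y v s) :=
  ((h.x_v.zpow_right hq0 s.1.1).mul_right hq0
    ((QComm.yePow_right hq0 h.x_y (h.e_x.symm hq0) rfl s.1.2).mul_right hq0
      (QComm.x_pow_mul_phi_pow_right hq0 (QComm.refl x) ((h.phi_x hq0).symm hq0) s.2.1 s.2.2))).congr (by ring)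

theorem phi_monomial (s : (ℤ × ℤ) × (ℕ × ℕ)) :
    QComm q (-s.1.2 - s.1.1) (phiOf q e x y) (ageingMonomial q e x y v s) :=
  (((h.phi_v hq0).zpow_right hq0 s.1.1).mul_right hq0
    ((QComm.yePow_right hq0 h.phi_y ((h.e_phi.symm hq0).congr (by norm_num)) rfl s.1.2).mul_right hq0
      (QComm.x_pow_mul_phi_pow_right hq0 (h.phi_x hq0) (QComm.refl _) s.2.1 s.2.2))).congr (by ring)

theorem v_monomial (s : (ℤ × ℤ) × (ℕ × ℕ)) :
    QComm q (-(s.1.2.toNat : ℤ) + 2 * ((-s.1.2).toNat : ℤ) + (s.2.1 + s.2.2)) (v : R)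
      (ageingMonomial q e x y v s) :=
  (((QComm.refl (v : R)).zpow_right hq0 s.1.1).mul_right hq0
    ((((h.y_v.symm hq0).pow_right hq0 _).mul_right hq0 ((h.e_v.symm hq0).pow_right hq0 _)).mul_right
      hq0 (QComm.x_pow_mul_phi_pow_right hq0 (h.x_v.symm hq0) ((h.phi_v hq0).symm hq0) s.2.1 s.2.2))).congr
    (by ring)

theorem y_monomial (s : (ℤ × ℤ) × (ℕ × ℕ)) (hs : 0 ≤ s.1.2) :
    QComm q (s.1.1 - s.2.1 + s.2.2) y (ageingMonomial q e x y v s) := by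
  obtain ⟨⟨n, m⟩, i, j⟩ := s
  obtain ⟨b, rfl⟩ := Int.eq_ofNat_of_zero_le hs
  refine ((h.y_v.zpow_right hq0 n).mul_right hq0 (QComm.mul_right hq0 (n := 0) ?_
    (QComm.x_pow_mul_phi_pow_right hq0 (h.x_y.symm hq0) (h.phi_y.symm hq0) i j))).congr (by ring)
  dsimp only
  rw [yePow_of_nat]
  exact ((QComm.refl y).pow_right hq0 b).congr (by ring)

theorem e_monomial (s : (ℤ × ℤ) × (ℕ × ℕ)) (hs : s.1.2 ≤ 0) :
    QComm q (-2 * s.1.1 + s.2.1 - s.2.2) e (ageingMonomial q e x y v s) := by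
  obtain ⟨⟨n, m⟩, i, j⟩ := s
  obtain ⟨b, hb⟩ := Int.eq_ofNat_of_zero_le (neg_nonneg.2 hs)
  obtain rfl : m = -b := by rw [← hb, neg_neg]
  refine ((h.e_v.zpow_right hq0 n).mul_right hq0 (QComm.mul_right hq0 (n := 0) ?_
    (QComm.x_pow_mul_phi_pow_right hq0 h.e_x h.e_phi i j))).congr (by ring)
  dsimp only
  rw [yePow_neg_of_nat]
  exact ((QComm.refl e).pow_right hq0 b).congr (by ring)

/-- Both `EY` and `YE` are combinations of `X` and `φ`. The twist `q^(-1-c)` is the one for which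
the `φ` contributions cancel, leaving a multiple of `Y^c X`. -/
theorem smul_e_mul_y_pow (c : ℕ) : (q⁻¹ - q) • (e * y ^ (c + 1) - q ^ (-1 - c : ℤ) •
    (y ^ (c + 1) * e)) = (q ^ (-1 - c : ℤ) - q ^ (1 + c : ℤ)) • (y ^ c * x) := by
  have h1 : phiOf q e x y * y ^ c = q ^ (-1 * c : ℤ) • (y ^ c * phiOf q e x y) :=
    h.phi_y.pow_right hq0 c
  have h2 : x * y ^ c = q ^ (1 * c : ℤ) • (y ^ c * x) := h.x_y.pow_right hq0 c
  have h3 := smul_y_mul_e (q := q) (e := e) (x := x) (y := y)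
  rw [smul_sub, smul_comm, pow_succ', ← mul_assoc, ← smul_mul_assoc, h.smul_e_mul_y, ← pow_succ',
    pow_succ, mul_assoc, ← mul_smul_comm, h3, sub_mul, smul_mul_assoc, smul_mul_assoc, h1, h2,
    smul_smul, smul_smul, mul_sub, smul_sub, sub_smul]
  rw [← zpow_neg_one, ← zpow_one_add₀ hq0, ← zpow_add₀ hq0,
    show (-1 + -1 * c : ℤ) = -1 - c by ring, show (1 + 1 * c : ℤ) = 1 + c by ring]
  abel

theorem smul_e_pow_mul_y (c : ℕ) : (q⁻¹ - q) • (e ^ (c + 1) * y - q ^ (-1 - c : ℤ) •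
    (y * e ^ (c + 1))) = (q ^ (-1 - 2 * c : ℤ) - q) • (e ^ c * x) := by
  have h1 : phiOf q e x y * e ^ c = q ^ (- -1 * c : ℤ) • (e ^ c * phiOf q e x y) :=
    (h.e_phi.symm hq0).pow_right hq0 c
  have h2 : x * e ^ c = q ^ (-1 * c : ℤ) • (e ^ c * x) := (h.e_x.symm hq0).pow_right hq0 c
  have h3 := smul_y_mul_e (q := q) (e := e) (x := x) (y := y)
  rw [smul_sub, smul_comm, pow_succ, mul_assoc, ← mul_smul_comm, h.smul_e_mul_y, ← pow_succ,
    pow_succ', ← mul_assoc, ← smul_mul_assoc, h3, sub_mul, h1, h2, mul_sub, mul_smul_comm,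
    mul_smul_comm, smul_sub, smul_smul, smul_smul, sub_smul]
  rw [← zpow_neg_one, ← zpow_add₀ hq0, ← zpow_add₀ hq0,
    show (-1 - c + - -1 * c : ℤ) = -1 by ring, show (-1 - c + -1 * c : ℤ) = -1 - 2 * c by ring]
  abel

variable (hq : ∀ n : ℕ, 0 < n → q ^ n ≠ 1)
include hq

/-- A twisted commutator with `E` replaces one factor `Y` by `X`. Its coefficient `q^(-1-c) -
q^(1+c)` is nonzero because `q` is not a root of unity, so all factors `Y` can be removed. -/
theorem exists_x_pow_mul_phi_pow_mem_of_y_pow (J : TwoSidedIdeal R) (c i j : ℕ)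
    (hJ : y ^ c * (x ^ i * phiOf q e x y ^ j) ∈ J) :
    ∃ i j : ℕ, x ^ i * phiOf q e x y ^ j ∈ J := by
  induction c generalizing i with
  | zero => exact ⟨i, j, by simpa using hJ⟩
  | succ c ih =>
    set t := x ^ i * phiOf q e x y ^ j with ht
    refine ih (i + 1) ?_
    have h1 : e * y ^ (c + 1) * t ∈ J := by
      rw [mul_assoc]
      exact J.mul_mem_left _ _ hJ
    have h2 : y ^ (c + 1) * e * t ∈ J := by
      have := J.mul_mem_right _ e hJ
      rw [mul_assoc] at this ⊢
      exact ((((QComm.x_pow_mul_phi_pow_right hq0 h.e_x h.e_phi i j).symm hq0).sim.mul_left hq0 _).mem_iff hq0).1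
        this
    have h3 : ((q⁻¹ - q) • (e * y ^ (c + 1) - q ^ (-1 - c : ℤ) • (y ^ (c + 1) * e))) * t ∈ J := by
      rw [smul_mul_assoc, sub_mul, smul_mul_assoc]
      exact smul_mem _ (J.sub_mem h1 (smul_mem _ h2))
    rw [h.smul_e_mul_y_pow hq0, smul_mul_assoc, smul_mem_iff, mul_assoc, ht, ← mul_assoc x,
      ← pow_succ'] at h3
    · exact h3
    · intro h0
      have := zpow_inj_of_not_root hq0 hq (sub_eq_zero.1 h0)
      omega

theorem exists_x_pow_mul_phi_pow_mem_of_e_pow (J : TwoSidedIdeal R) (c i j : ℕ)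
    (hJ : e ^ c * (x ^ i * phiOf q e x y ^ j) ∈ J) :
    ∃ i j : ℕ, x ^ i * phiOf q e x y ^ j ∈ J := by
  induction c generalizing i with
  | zero => exact ⟨i, j, by simpa using hJ⟩
  | succ c ih =>
    set t := x ^ i * phiOf q e x y ^ j with ht
    refine ih (i + 1) ?_
    have h1 : y * e ^ (c + 1) * t ∈ J := by
      rw [mul_assoc]
      exact J.mul_mem_left _ _ hJ
    have h2 : e ^ (c + 1) * y * t ∈ J := by
      have := J.mul_mem_right _ y hJ
      rw [mul_assoc] at this ⊢
      exact ((((QComm.x_pow_mul_phi_pow_right hq0 (h.x_y.symm hq0) (h.phi_y.symm hq0) i j).symm hq0).sim.mul_left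
        hq0 _).mem_iff hq0).1 this
    have h3 : ((q⁻¹ - q) • (e ^ (c + 1) * y - q ^ (-1 - c : ℤ) • (y * e ^ (c + 1)))) * t ∈ J := by
      rw [smul_mul_assoc, sub_mul, smul_mul_assoc]
      exact smul_mem _ (J.sub_mem h2 (smul_mem _ h1))
    rw [h.smul_e_pow_mul_y hq0, smul_mul_assoc, smul_mem_iff, mul_assoc, ht, ← mul_assoc x,
      ← pow_succ'] at h3
    · exact h3
    · intro h0
      have := zpow_inj_of_not_root hq0 hq ((sub_eq_zero.1 h0).trans (zpow_one q).symm)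
      omega

/-- A two-sided ideal containing a nontrivial combination of the monomials contains a product of
powers of the normal elements `X` and `φ`. -/
theorem exists_x_pow_mul_phi_pow_mem (J : TwoSidedIdeal R) (c : (ℤ × ℤ) × (ℕ × ℕ) →₀ k)
    (hc : c ≠ 0) (hJ : c.sum (fun s t => t • ageingMonomial q e x y v s) ∈ J) :
    ∃ i j : ℕ, x ^ i * phiOf q e x y ^ j ∈ J := by
  classical
  obtain ⟨s₀, hs₀⟩ := Finsupp.support_nonempty_iff.2 hc
  obtain ⟨N, hN⟩ := exists_weight_component_mem hq0 hq J x (s₀.1.2 - s₀.1.1)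
    (fun s => s.1.2 - s.1.1) c.support (fun s => c s • ageingMonomial q e x y v s)
    (fun s _ => (h.x_monomial hq0 s).smul_right _) hJ
  obtain ⟨N', hN'⟩ := exists_weight_component_mem hq0 hq J (phiOf q e x y) (-s₀.1.2 - s₀.1.1)
    (fun s => -s.1.2 - s.1.1) _ (fun s => c s • ageingMonomial q e x y v s * x ^ N)
    (fun s _ => ((((h.phi_monomial hq0 s).smul_right _).mul_right hq0
      ((h.phi_x hq0).pow_right hq0 N))).congr (by ring)) hN
  -- The `X`-weight `m - n` and the `φ`-weight `-m - n` together determine the exponents `n` of `K`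
  -- and `m` of `Y`.
  have hmem : ∀ s : (ℤ × ℤ) × (ℕ × ℕ), (s.1.2 - s.1.1 = s₀.1.2 - s₀.1.1 ∧ -s.1.2 - s.1.1 = -s₀.1.2 - s₀.1.1) ↔
      s.1 = s₀.1 := by
    intro s
    rw [Prod.ext_iff]
    omega
  rw [Finset.filter_filter, Finset.filter_congr fun s _ => hmem s] at hN'
  -- With `n` and `m` fixed, the `K`-weight fixes `i + j`. The difference `i - j` is then read off
  -- with `Y` if `m ≥ 0` and with `E` if `m ≤ 0`, where that generator `q`-commutes with the
  -- monomial.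
  have h3 := weight_component_mem_of_unit hq0 hq J v
    (-(s₀.1.2.toNat : ℤ) + 2 * ((-s₀.1.2).toNat : ℤ) + (s₀.2.1 + s₀.2.2) + N + N')
    (fun s => -(s.1.2.toNat : ℤ) + 2 * ((-s.1.2).toNat : ℤ) + (s.2.1 + s.2.2) + N + N') _
    (fun s => c s • ageingMonomial q e x y v s * x ^ N * phiOf q e x y ^ N')
    (fun s _ => ((((h.v_monomial hq0 s).smul_right (c s)).mul_right hq0
      ((h.x_v.symm hq0).pow_right hq0 N)).mul_right hq0
        (((h.phi_v hq0).symm hq0).pow_right hq0 N')).congr (by ring)) hN'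
  rw [Finset.filter_filter] at h3
  have hcomb : ∀ s : (ℤ × ℤ) × (ℕ × ℕ), ageingMonomial q e x y v s * x ^ N * phiOf q e x y ^ N'
      = (v ^ s.1.1 : Rˣ) * (yePow e y s.1.2 * (x ^ (s.2.1 + N) * phiOf q e x y ^ (s.2.2 + N'))) := by
    intro s
    have := ((h.commute_x_phi hq0).symm.pow_pow s.2.2 N).eq
    simp only [ageingMonomial, mul_assoc, pow_add]
    rw [← mul_assoc (phiOf q e x y ^ s.2.2) (x ^ N), this]
    simp only [mul_assoc]
  rcases le_total 0 s₀.1.2 with hpos | hneg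
  · obtain ⟨M, hM⟩ := exists_weight_component_mem hq0 hq J y
      (s₀.1.1 - s₀.2.1 + s₀.2.2 + (-N + N'))
      (fun s => s.1.1 - s.2.1 + s.2.2 + (-N + N')) _
      (fun s => c s • ageingMonomial q e x y v s * x ^ N * phiOf q e x y ^ N')
      (fun s hs => ((((h.y_monomial hq0 s (by
        rw [(Finset.mem_filter.1 hs).2.1]; exact hpos)).smul_right (c s)).mul_right hq0
          ((h.x_y.symm hq0).pow_right hq0 N)).mul_right hq0
            ((h.phi_y.symm hq0).pow_right hq0 N')).congr (by ring)) h3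
    rw [Finset.filter_filter, Finset.sum_eq_single_of_mem s₀ (by simp [hs₀])] at hM
    · rw [smul_mul_assoc, smul_mul_assoc, smul_mul_assoc,
        smul_mem_iff (Finsupp.mem_support_iff.1 hs₀), hcomb, mul_assoc, unit_mul_mem_iff] at hM
      obtain ⟨b, hb⟩ := Int.eq_ofNat_of_zero_le hpos
      rw [hb, yePow_of_nat, mul_assoc, (((((QComm.x_pow_mul_phi_pow_right hq0 (h.x_y.symm hq0) (h.phi_y.symm hq0)
        _ _).symm hq0).pow_right hq0 M).sim.mul_left hq0 _).mem_iff hq0), ← mul_assoc,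
        ← pow_add] at hM
      exact h.exists_x_pow_mul_phi_pow_mem_of_y_pow hq0 hq J _ _ _ hM
    · intro s hs hne
      refine absurd ?_ hne
      obtain ⟨-, ⟨h1, h2⟩, h3⟩ := Finset.mem_filter.1 hs
      rw [h1] at h2 h3
      exact Prod.ext h1 (Prod.ext (by omega) (by omega))
  · obtain ⟨M, hM⟩ := exists_weight_component_mem hq0 hq J e
      (-2 * s₀.1.1 + s₀.2.1 - s₀.2.2 + (N - N'))
      (fun s => -2 * s.1.1 + s.2.1 - s.2.2 + (N - N')) _
      (fun s => c s • ageingMonomial q e x y v s * x ^ N * phiOf q e x y ^ N')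
      (fun s hs => ((((h.e_monomial hq0 s (by
        rw [(Finset.mem_filter.1 hs).2.1]; exact hneg)).smul_right (c s)).mul_right hq0
          (h.e_x.pow_right hq0 N)).mul_right hq0
            (h.e_phi.pow_right hq0 N')).congr (by ring)) h3
    rw [Finset.filter_filter, Finset.sum_eq_single_of_mem s₀ (by simp [hs₀])] at hM
    · rw [smul_mul_assoc, smul_mul_assoc, smul_mul_assoc,
        smul_mem_iff (Finsupp.mem_support_iff.1 hs₀), hcomb, mul_assoc, unit_mul_mem_iff] at hM
      obtain ⟨b, hb⟩ := Int.eq_ofNat_of_zero_le (neg_nonneg.2 hneg)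
      rw [← neg_neg s₀.1.2, hb, yePow_neg_of_nat, mul_assoc, (((((QComm.x_pow_mul_phi_pow_right hq0 h.e_x h.e_phi
        _ _).symm hq0).pow_right hq0 M).sim.mul_left hq0 _).mem_iff hq0), ← mul_assoc,
        ← pow_add] at hM
      exact h.exists_x_pow_mul_phi_pow_mem_of_e_pow hq0 hq J _ _ _ hM
    · intro s hs hne
      refine absurd ?_ hne
      obtain ⟨-, ⟨h1, h2⟩, h3⟩ := Finset.mem_filter.1 hs
      rw [h1] at h2 h3
      exact Prod.ext h1 (Prod.ext (by omega) (by omega))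

end IsAgeing

end Ageing

/-! ### Spanning families for images of the algebra -/

section Spanning

variable {k : Type u} [Field k] {q : k} {R : Type*} [Ring R] [Algebra k R]

/-- The image of `K` under a homomorphism, as a unit. -/
abbrev mapK (π : Alg q →ₐ[k] R) : Rˣ := Units.map (π : Alg q →* R) (K q)

theorem isAgeing_map (π : Alg q →ₐ[k] R) :
    IsAgeing q (π (E q)) (π (X q)) (π (Y q)) (mapK π) :=
  (isAgeing_alg q).map π

theorem map_phi (π : Alg q →ₐ[k] R) : π (phi q) = phiOf q (π (E q)) (π (X q)) (π (Y q)) := by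
  rw [phi_eq, map_phiOf]

theorem map_zOf (π : Alg q →ₐ[k] R) (ε : ℤ) :
    π (zOf ε (E q) (Y q) (K q)) = zOf ε (π (E q)) (π (Y q)) (mapK π) := by
  rw [zOf, zOf, map_mul, map_mul, map_pow, ← map_zpow]
  rfl

/-- A family whose span contains `1` and is stable under left multiplication by the images of the
generators spans the image. -/
theorem exists_finsupp_sum_eq {ι : Type*} (π : Alg q →ₐ[k] R) (w : ι → R)
    (h1 : 1 ∈ Submodule.span k (Set.range w))
    (hE : ∀ s, π (E q) * w s ∈ Submodule.span k (Set.range w))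
    (hY : ∀ s, π (Y q) * w s ∈ Submodule.span k (Set.range w))
    (hK : ∀ s, (mapK π : R) * w s ∈ Submodule.span k (Set.range w))
    (hK' : ∀ s, ((mapK π)⁻¹ : Rˣ) * w s ∈ Submodule.span k (Set.range w)) (a : Alg q) :
    ∃ c : ι →₀ k, c.sum (fun s t => t • w s) = π a := by
  set S := Submodule.span k (Set.range w) with hS
  have key : ∀ r : R, (∀ s, r * w s ∈ S) → ∀ b ∈ S, r * b ∈ S := by
    intro r hr b hb
    have : S ≤ S.comap (LinearMap.mulLeft k r) := by
      refine Submodule.span_le.2 ?_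
      rintro _ ⟨s, rfl⟩
      exact hr s
    exact this hb
  have htop : S.comap π.toLinearMap = ⊤ := by
    refine submodule_eq_top_of_mul_mem _ (by simpa using h1) ?_ ?_ ?_ ?_
    · intro a ha
      simpa using key _ hE _ ha
    · intro a ha
      simpa using key _ hY _ ha
    · intro a ha
      simpa using key _ hK _ ha
    · intro a ha
      simpa using key _ hK' _ ha
  have ha : a ∈ S.comap π.toLinearMap := htop ▸ Submodule.mem_top
  exact Finsupp.mem_span_range_iff_exists_finsupp.1 ha

theorem mul_zpow_mul_mem {S : Submodule k R} {g b : R} {v : Rˣ} {m : ℤ} (hq0 : q ≠ 0)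
    (h : QComm q m g (v : R)) (n : ℤ) (hb : (v ^ n : Rˣ) * (g * b) ∈ S) :
    g * ((v ^ n : Rˣ) * b) ∈ S := by
  have := h.zpow_right hq0 n
  unfold QComm at this
  rw [← mul_assoc, this, smul_mul_assoc, mul_assoc]
  exact S.smul_mem _ hb

/-- Treats the quotients by `(Y)` and by `(E)` together: one of the two generators dies and `g` is
the other. -/
theorem exists_finsupp_pow_sum (hq0 : q ≠ 0) (π : Alg q →ₐ[k] R) {g : R} {d : ℤ}
    (hg : QComm q d g (mapK π : R)) (hE : π (E q) = 0 ∨ π (E q) = g)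
    (hY : π (Y q) = 0 ∨ π (Y q) = g) (a : Alg q) :
    ∃ c : ℤ × ℕ →₀ k, c.sum (fun s t => t • ((mapK π ^ s.1 : Rˣ) * g ^ s.2 : R)) = π a := by
  have hsub : ∀ s : ℤ × ℕ, ((mapK π ^ s.1 : Rˣ) * g ^ s.2 : R) ∈
      Submodule.span k (Set.range fun s : ℤ × ℕ => ((mapK π ^ s.1 : Rˣ) * g ^ s.2 : R)) :=
    fun s => Submodule.subset_span ⟨s, rfl⟩
  have hgen : ∀ r : R, (r = 0 ∨ r = g) → ∀ s : ℤ × ℕ, r * ((mapK π ^ s.1 : Rˣ) * g ^ s.2 : R) ∈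
      Submodule.span k (Set.range fun s : ℤ × ℕ => ((mapK π ^ s.1 : Rˣ) * g ^ s.2 : R)) := by
    rintro r (rfl | rfl) s
    · rw [zero_mul]
      exact Submodule.zero_mem _
    · refine mul_zpow_mul_mem hq0 hg _ ?_
      rw [← pow_succ']
      exact hsub (s.1, s.2 + 1)
  refine exists_finsupp_sum_eq π _ ?_ (hgen _ hE) (hgen _ hY) (fun s => ?_) (fun s => ?_) a
  · simpa using hsub (0, 0)
  · rw [← mul_assoc, ← Units.val_mul, ← zpow_one_add]
    exact hsub (1 + s.1, s.2)
  · rw [← mul_assoc, ← Units.val_mul, ← zpow_neg_one, ← zpow_add]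
    exact hsub (-1 + s.1, s.2)

theorem exists_finsupp_monomial_sum (hq0 : q ≠ 0) (π : Alg q →ₐ[k] R) {ε : ℤ}
    (h : IsQuantumSpace q ε (π (E q)) (π (Y q)) (mapK π)) (a : Alg q) :
    ∃ c : ℤ × ℕ × ℕ →₀ k,
      c.sum (fun s t => t • monomialOf (π (E q)) (π (Y q)) (mapK π) s) = π a := by
  have hsub : ∀ s, monomialOf (π (E q)) (π (Y q)) (mapK π) s ∈
      Submodule.span k (Set.range (monomialOf (π (E q)) (π (Y q)) (mapK π))) :=
    fun s => Submodule.subset_span ⟨s, rfl⟩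
  refine exists_finsupp_sum_eq π _ ?_ (fun s => ?_) (fun s => ?_) (fun s => ?_) (fun s => ?_) a
  · simpa [monomialOf] using hsub (0, 0, 0)
  · refine mul_zpow_mul_mem hq0 h.e_v _ ?_
    have := h.e_y.pow_right hq0 s.2.1
    unfold QComm at this
    rw [← mul_assoc (π (E q)), this, smul_mul_assoc, mul_assoc, ← pow_succ', mul_smul_comm]
    exact Submodule.smul_mem _ _ (hsub (s.1, s.2.1, s.2.2 + 1))
  · refine mul_zpow_mul_mem hq0 h.y_v _ ?_
    rw [← mul_assoc (π (Y q)), ← pow_succ']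
    exact hsub (s.1, s.2.1 + 1, s.2.2)
  · rw [monomialOf, ← mul_assoc, ← Units.val_mul, ← zpow_one_add]
    exact hsub (1 + s.1, s.2)
  · rw [monomialOf, ← mul_assoc, ← Units.val_mul, ← zpow_neg_one, ← zpow_add]
    exact hsub (-1 + s.1, s.2)

/-- When `E` meets a positive power of `Y`, or `Y` a positive power of `E`, the product `EY` or `YE`
is rewritten through `X` and `φ`, which pass to the right by normality. The rewriting divides by
`q⁻¹ - q`. -/
theorem exists_finsupp_ageingMonomial_sum (hq0 : q ≠ 0) (hq : ∀ n : ℕ, 0 < n → q ^ n ≠ 1)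
    (π : Alg q →ₐ[k] R) (a : Alg q) :
    ∃ c : (ℤ × ℤ) × (ℕ × ℕ) →₀ k,
      c.sum (fun s t => t • ageingMonomial q (π (E q)) (π (X q)) (π (Y q)) (mapK π) s) = π a := by
  have h := isAgeing_map π
  have hδ := inv_sub_ne_zero hq0 hq
  set e := π (E q)
  set x := π (X q)
  set y := π (Y q)
  set v := mapK π
  set φ := phiOf q e x y with hφ
  set S := Submodule.span k (Set.range (ageingMonomial q e x y v)) with hS
  have hsub : ∀ (n m : ℤ) (i j : ℕ), (v ^ n : Rˣ) * (yePow e y m * (x ^ i * φ ^ j)) ∈ S :=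
    fun n m i j => Submodule.subset_span ⟨((n, m), (i, j)), rfl⟩
  have hx : ∀ (n m : ℤ) (i j : ℕ) (r : ℤ), QComm q r x (yePow e y m) →
      (v ^ n : Rˣ) * (x * (yePow e y m * (x ^ i * φ ^ j))) ∈ S := by
    intro n m i j r hr
    unfold QComm at hr
    rw [← mul_assoc x, hr, smul_mul_assoc, mul_assoc, ← mul_assoc x, ← pow_succ', mul_smul_comm]
    exact S.smul_mem _ (hsub _ _ _ _)
  have hp : ∀ (n m : ℤ) (i j : ℕ) (r : ℤ), QComm q r φ (yePow e y m) →
      (v ^ n : Rˣ) * (φ * (yePow e y m * (x ^ i * φ ^ j))) ∈ S := by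
    intro n m i j r hr
    unfold QComm at hr
    rw [← mul_assoc φ, hr, smul_mul_assoc, mul_assoc, ← mul_assoc φ,
      ← ((h.commute_x_phi hq0).pow_left i).eq, mul_assoc, ← pow_succ', mul_smul_comm]
    exact S.smul_mem _ (hsub _ _ _ _)
  have hxm : ∀ m, ∃ r, QComm q r x (yePow e y m) := fun m =>
    ⟨_, QComm.yePow_right hq0 h.x_y (h.e_x.symm hq0) rfl m⟩
  have hpm : ∀ m, ∃ r, QComm q r φ (yePow e y m) := fun m =>
    ⟨_, QComm.yePow_right hq0 h.phi_y ((h.e_phi.symm hq0).congr (by norm_num)) rfl m⟩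
  have hye : ∀ (n m : ℤ) (i j : ℕ), (v ^ n : Rˣ) * ((y * e) * (yePow e y m * (x ^ i * φ ^ j))) ∈ S := by
    intro n m i j
    obtain ⟨r, hr⟩ := hxm m
    obtain ⟨r', hr'⟩ := hpm m
    rw [← S.smul_mem_iff hδ, ← mul_smul_comm, ← smul_mul_assoc, IsAgeing.smul_y_mul_e (x := x),
      sub_mul, mul_sub]
    exact S.sub_mem (hp _ _ _ _ _ hr') (hx _ _ _ _ _ hr)
  have hey : ∀ (n m : ℤ) (i j : ℕ), (v ^ n : Rˣ) * ((e * y) * (yePow e y m * (x ^ i * φ ^ j))) ∈ S := by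
    intro n m i j
    obtain ⟨r, hr⟩ := hxm m
    rw [h.e_mul_y, add_mul, mul_add, smul_mul_assoc, mul_smul_comm]
    exact S.add_mem (hx _ _ _ _ _ hr) (S.smul_mem _ (hye _ _ _ _))
  refine exists_finsupp_sum_eq π _ ?_ ?_ ?_ ?_ ?_ a
  · simpa [yePow] using hsub 0 0 0 0
  · rintro ⟨⟨n, m⟩, i, j⟩
    refine mul_zpow_mul_mem hq0 h.e_v _ ?_
    change (v ^ n : Rˣ) * (e * (yePow e y m * (x ^ i * φ ^ j))) ∈ S
    rcases lt_or_ge 0 m with hm | hm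
    · obtain ⟨b, rfl⟩ : ∃ b : ℕ, m = (b + 1 : ℕ) := ⟨(m - 1).toNat, by omega⟩
      have := hey n b i j
      rw [yePow_of_nat] at this
      rwa [yePow_of_nat, pow_succ', mul_assoc y, ← mul_assoc e]
    · obtain ⟨b, rfl⟩ : ∃ b : ℕ, m = -(b : ℤ) := ⟨(-m).toNat, by omega⟩
      have := hsub n (-(b + 1 : ℕ)) i j
      rw [yePow_neg_of_nat] at this
      rwa [yePow_neg_of_nat, ← mul_assoc e, ← pow_succ']
  · rintro ⟨⟨n, m⟩, i, j⟩
    refine mul_zpow_mul_mem hq0 h.y_v _ ?_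
    change (v ^ n : Rˣ) * (y * (yePow e y m * (x ^ i * φ ^ j))) ∈ S
    rcases lt_or_ge m 0 with hm | hm
    · obtain ⟨b, rfl⟩ : ∃ b : ℕ, m = -((b + 1 : ℕ) : ℤ) := ⟨(-m - 1).toNat, by omega⟩
      have := hye n (-(b : ℤ)) i j
      rw [yePow_neg_of_nat] at this
      rwa [yePow_neg_of_nat, pow_succ', mul_assoc e, ← mul_assoc y]
    · obtain ⟨b, rfl⟩ : ∃ b : ℕ, m = (b : ℤ) := ⟨m.toNat, by omega⟩
      have := hsub n (b + 1 : ℕ) i j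
      rw [yePow_of_nat] at this
      rwa [yePow_of_nat, ← mul_assoc y, ← pow_succ']
  · rintro ⟨⟨n, m⟩, i, j⟩
    rw [ageingMonomial, ← mul_assoc, ← Units.val_mul, ← zpow_one_add]
    exact hsub _ _ _ _
  · rintro ⟨⟨n, m⟩, i, j⟩
    rw [ageingMonomial, ← mul_assoc, ← Units.val_mul, ← zpow_neg_one, ← zpow_add]
    exact hsub _ _ _ _

/-- Every nonzero two-sided ideal contains a product of powers of `X` and `φ`. -/
theorem exists_X_pow_mul_phi_pow_mem (hq0 : q ≠ 0) (hq : ∀ n : ℕ, 0 < n → q ^ n ≠ 1)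
    (I : TwoSidedIdeal (Alg q)) {a : Alg q} (ha : a ∈ I) (ha0 : a ≠ 0) :
    ∃ i j : ℕ, X q ^ i * phi q ^ j ∈ I := by
  obtain ⟨c, hc⟩ := exists_finsupp_ageingMonomial_sum hq0 hq (AlgHom.id k (Alg q)) a
  have h := isAgeing_map (AlgHom.id k (Alg q))
  obtain ⟨i, j, hij⟩ := h.exists_x_pow_mul_phi_pow_mem hq0 hq I c (by
    rintro rfl
    exact ha0 (by simpa using hc.symm)) (by rw [hc]; exact ha)
  refine ⟨i, j, ?_⟩
  rw [← map_phi] at hij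
  exact hij

end Spanning

/-! ### Irreducible representations, prime quotients, and regular normal elements -/

section Primitive

variable {k : Type u} [Field k]

/-- A representation is irreducible if it is nonzero and has no proper nonzero subrepresentation. -/
def IsIrreducibleRep {A V : Type*} [Ring A] [Algebra k A] [AddCommGroup V] [Module k V]
    (ρ : A →ₐ[k] Module.End k V) : Prop :=
  Nontrivial V ∧ ∀ N : Submodule k V, (∀ a, ∀ v ∈ N, ρ a v ∈ N) → N = ⊥ ∨ N = ⊤

theorem IsPrimitiveIdeal.exists_rep {A : Type u} [Ring A] [Algebra k A] {P : TwoSidedIdeal A}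
    (hP : IsPrimitiveIdeal P) :
    ∃ (V : Type u) (_ : AddCommGroup V) (_ : Module k V) (ρ : A →ₐ[k] Module.End k V),
      IsIrreducibleRep ρ ∧ ∀ a, a ∈ P ↔ ρ a = 0 := by
  obtain ⟨M, _, _, hM, hann⟩ := hP
  let _ : Module k M := Module.compHom M (algebraMap k A)
  have _ : IsScalarTower k A M := ⟨fun t a m => by
    rw [Algebra.smul_def, mul_smul]
    rfl⟩
  refine ⟨M, inferInstance, inferInstance, Algebra.lsmul k k M, ⟨IsSimpleModule.nontrivial A M,
    fun N hN => ?_⟩, fun a => ?_⟩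
  · let N' : Submodule A M := { N with smul_mem' := fun a m hm => hN a m hm }
    rcases eq_bot_or_eq_top N' with h | h
    · left
      refine (Submodule.eq_bot_iff _).2 fun m hm => ?_
      exact (Submodule.eq_bot_iff N').1 h m hm
    · right
      refine Submodule.eq_top_iff'.2 fun m => ?_
      exact Submodule.eq_top_iff'.1 h m
  · rw [← TwoSidedIdeal.mem_asIdeal, hann, Module.mem_annihilator]
    exact ⟨fun h => LinearMap.ext h, fun h m => LinearMap.congr_fun h m⟩

theorem isPrimitiveIdeal_of_rep {A : Type u} [Ring A] [Algebra k A] {P : TwoSidedIdeal A}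
    {V : Type u} [AddCommGroup V] [Module k V] (ρ : A →ₐ[k] Module.End k V)
    (hρ : IsIrreducibleRep ρ) (hP : ∀ a, a ∈ P ↔ ρ a = 0) : IsPrimitiveIdeal P := by
  let _ : Module A V := Module.compHom V ρ.toRingHom
  have _ : Nontrivial V := hρ.1
  have hsmul : ∀ (a : A) (v : V), a • v = ρ a v := fun _ _ => rfl
  refine ⟨V, inferInstance, inferInstance, ?_, ?_⟩
  · have : IsSimpleOrder (Submodule A V) :=
      { eq_bot_or_eq_top := fun N => by
          let N' : Submodule k V := { N with
            smul_mem' := fun t v hv => by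
              have := N.smul_mem (algebraMap k A t) hv
              rwa [hsmul, AlgHom.commutes] at this }
          rcases hρ.2 N' fun a v hv => N.smul_mem a hv with h | h
          · left
            refine (Submodule.eq_bot_iff _).2 fun m hm => ?_
            exact (Submodule.eq_bot_iff N').1 h m hm
          · right
            refine Submodule.eq_top_iff'.2 fun m => ?_
            exact Submodule.eq_top_iff'.1 h m }
    exact (isSimpleModule_iff A V).2 this
  · ext a
    rw [TwoSidedIdeal.mem_asIdeal, hP, Module.mem_annihilator]
    exact ⟨fun h m => LinearMap.congr_fun h m, fun h => LinearMap.ext h⟩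

/-- If `b` moves some `v` to a nonzero vector, the orbit of `bv` is all of `V` by irreducibility,
and `a` kills this orbit. -/
theorem IsIrreducibleRep.eq_zero_or_eq_zero {A V : Type*} [Ring A] [Algebra k A] [AddCommGroup V]
    [Module k V] {ρ : A →ₐ[k] Module.End k V} (hρ : IsIrreducibleRep ρ) {a b : A}
    (h : ∀ r, ρ (a * r * b) = 0) : ρ a = 0 ∨ ρ b = 0 := by
  by_contra! hne
  obtain ⟨v, hv⟩ : ∃ v, ρ b v ≠ 0 := by
    by_contra! h0
    exact hne.2 (LinearMap.ext h0)
  let N : Submodule k V := LinearMap.range ((LinearMap.applyₗ (ρ b v)).comp ρ.toLinearMap)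
  rcases hρ.2 N (by
    rintro r _ ⟨s, rfl⟩
    refine ⟨r * s, ?_⟩
    change ρ (r * s) (ρ b v) = ρ r (ρ s (ρ b v))
    rw [map_mul, Module.End.mul_apply]) with h0 | h1
  · refine hv ((Submodule.eq_bot_iff N).1 h0 _ ⟨1, ?_⟩)
    change ρ 1 (ρ b v) = ρ b v
    rw [map_one, Module.End.one_apply]
  · refine hne.1 (LinearMap.ext fun w => ?_)
    obtain ⟨s, rfl⟩ : w ∈ N := h1 ▸ Submodule.mem_top
    change ρ a (ρ s (ρ b v)) = 0
    rw [← Module.End.mul_apply, ← Module.End.mul_apply, ← map_mul, ← map_mul, h]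
    rfl

/-- The quotient by a primitive ideal is a prime ring. -/
theorem IsPrimitiveIdeal.eq_zero_or_eq_zero {A R : Type u} [Ring A] [Algebra k A] [Ring R]
    [Algebra k R] {P : TwoSidedIdeal A} (hP : IsPrimitiveIdeal P) (π : A →ₐ[k] R)
    (hπ : Function.Surjective π) (hker : ∀ a, π a = 0 ↔ a ∈ P) (a b : R)
    (h : ∀ r, a * r * b = 0) : a = 0 ∨ b = 0 := by
  obtain ⟨V, _, _, ρ, hρ, hPρ⟩ := hP.exists_rep (k := k)
  obtain ⟨a, rfl⟩ := hπ a
  obtain ⟨b, rfl⟩ := hπ b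
  rw [hker, hker, hPρ, hPρ]
  refine hρ.eq_zero_or_eq_zero fun r => ?_
  rw [← hPρ, ← hker, map_mul, map_mul]
  exact h _

variable {q : k} {R : Type*} [Ring R] [Algebra k R]

/-- Half of the normality of `g`. Commutation up to scalars with the generators suffices because the
admissible elements form a subspace stable under left multiplication by them. -/
theorem exists_mul_eq_mul_left (hq0 : q ≠ 0) (π : Alg q →ₐ[k] R) (hπ : Function.Surjective π)
    {g : R} {n₁ n₂ n₃ : ℤ} (hE : QComm q n₁ g (π (E q))) (hY : QComm q n₂ g (π (Y q)))
    (hK : QComm q n₃ g (mapK π : R)) (r : R) : ∃ r', g * r = r' * g := by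
  obtain ⟨a, rfl⟩ := hπ r
  let S : Submodule k (Alg q) :=
    { carrier := {a | ∃ r', g * π a = r' * g}
      zero_mem' := ⟨0, by simp⟩
      add_mem' := by
        rintro a b ⟨r, hr⟩ ⟨s, hs⟩
        exact ⟨r + s, by rw [map_add, mul_add, hr, hs, add_mul]⟩
      smul_mem' := by
        rintro t a ⟨r, hr⟩
        exact ⟨t • r, by rw [map_smul, mul_smul_comm, hr, smul_mul_assoc]⟩ }
  have key : ∀ (h : Alg q) (n : ℤ), QComm q n g (π h) → ∀ a ∈ S, h * a ∈ S := by
    rintro h n hn a ⟨r, hr⟩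
    unfold QComm at hn
    refine ⟨q ^ n • (π h * r), ?_⟩
    rw [map_mul, ← mul_assoc, hn, smul_mul_assoc, mul_assoc, hr, smul_mul_assoc, mul_assoc]
  have htop : S = ⊤ := submodule_eq_top_of_mul_mem S ⟨1, by simp⟩ (key _ _ hE) (key _ _ hY)
    (key _ _ hK) (key _ _ (hK.inv_right hq0))
  exact (htop ▸ Submodule.mem_top : a ∈ S)

theorem exists_mul_eq_mul_right (hq0 : q ≠ 0) (π : Alg q →ₐ[k] R) (hπ : Function.Surjective π)
    {g : R} {n₁ n₂ n₃ : ℤ} (hE : QComm q n₁ g (π (E q))) (hY : QComm q n₂ g (π (Y q)))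
    (hK : QComm q n₃ g (mapK π : R)) (r : R) : ∃ r', r * g = g * r' := by
  obtain ⟨a, rfl⟩ := hπ r
  let S : Submodule k (Alg q) :=
    { carrier := {a | ∃ r', π a * g = g * r'}
      zero_mem' := ⟨0, by simp⟩
      add_mem' := by
        rintro a b ⟨r, hr⟩ ⟨s, hs⟩
        exact ⟨r + s, by rw [map_add, add_mul, hr, hs, mul_add]⟩
      smul_mem' := by
        rintro t a ⟨r, hr⟩
        exact ⟨t • r, by rw [map_smul, smul_mul_assoc, hr, mul_smul_comm]⟩ }
  have key : ∀ (h : Alg q) (n : ℤ), QComm q n g (π h) → ∀ a ∈ S, h * a ∈ S := by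
    rintro h n hn a ⟨r, hr⟩
    have hn' := hn.symm hq0
    unfold QComm at hn'
    refine ⟨q ^ (-n) • (π h * r), ?_⟩
    rw [map_mul, mul_assoc, hr, ← mul_assoc, hn', smul_mul_assoc, mul_assoc, mul_smul_comm]
  have htop : S = ⊤ := submodule_eq_top_of_mul_mem S ⟨1, by simp⟩ (key _ _ hE) (key _ _ hY)
    (key _ _ hK) (key _ _ (hK.inv_right hq0))
  exact (htop ▸ Submodule.mem_top : a ∈ S)

/-- Nonzero elements of a prime quotient which `q`-commute with the generators are regular. -/
theorem mul_ne_zero_of_qComm (hq0 : q ≠ 0) (π : Alg q →ₐ[k] R) (hπ : Function.Surjective π)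
    (hR : ∀ a b : R, (∀ r, a * r * b = 0) → a = 0 ∨ b = 0)
    {g : R} {n₁ n₂ n₃ : ℤ} (hE : QComm q n₁ g (π (E q))) (hY : QComm q n₂ g (π (Y q)))
    (hK : QComm q n₃ g (mapK π : R)) (hg : g ≠ 0) {b : R} (hb : b ≠ 0) :
    g * b ≠ 0 ∧ b * g ≠ 0 := by
  constructor <;> intro h
  · refine (hR g b fun r => ?_).elim hg hb
    obtain ⟨r', hr'⟩ := exists_mul_eq_mul_left hq0 π hπ hE hY hK r
    rw [hr', mul_assoc, h, mul_zero]
  · refine (hR b g fun r => ?_).elim hb hg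
    obtain ⟨r', hr'⟩ := exists_mul_eq_mul_right hq0 π hπ hE hY hK r
    rw [mul_assoc, hr', ← mul_assoc, h, zero_mul]

theorem pow_mul_ne_zero_of_qComm (hq0 : q ≠ 0) (π : Alg q →ₐ[k] R) (hπ : Function.Surjective π)
    (hR : ∀ a b : R, (∀ r, a * r * b = 0) → a = 0 ∨ b = 0)
    {g : R} {n₁ n₂ n₃ : ℤ} (hE : QComm q n₁ g (π (E q))) (hY : QComm q n₂ g (π (Y q)))
    (hK : QComm q n₃ g (mapK π : R)) (hg : g ≠ 0) {b : R} (hb : b ≠ 0) (i : ℕ) :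
    g ^ i * b ≠ 0 ∧ b * g ^ i ≠ 0 := by
  induction i with
  | zero => simpa using hb
  | succ i ih =>
    constructor
    · rw [pow_succ', mul_assoc]
      exact (mul_ne_zero_of_qComm hq0 π hπ hR hE hY hK hg ih.1).1
    · rw [pow_succ, ← mul_assoc]
      exact (mul_ne_zero_of_qComm hq0 π hπ hR hE hY hK hg ih.2).2

theorem isQuantumSpace_of_X (π : Alg q →ₐ[k] R) (hX : π (X q) = 0) :
    IsQuantumSpace q (-1) (π (E q)) (π (Y q)) (mapK π) where
  e_v := (isAgeing_map π).e_v
  y_v := (isAgeing_map π).y_v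
  e_y := by
    have := (isAgeing_map π).e_mul_y
    rw [hX, zero_add] at this
    unfold QComm
    rw [zpow_neg_one, this]

theorem isQuantumSpace_of_phi (π : Alg q →ₐ[k] R) (hphi : π (phi q) = 0) :
    IsQuantumSpace q 1 (π (E q)) (π (Y q)) (mapK π) where
  e_v := (isAgeing_map π).e_v
  y_v := (isAgeing_map π).y_v
  e_y := by
    have h := (isAgeing_map π).e_mul_y
    rw [map_phi, phiOf, sub_smul] at hphi
    unfold QComm
    rw [zpow_one, h, ← sub_eq_zero, ← hphi]
    abel

end Primitive

/-! ### Every primitive ideal is maximal or one of `(Y)`, `(E)`, `0` -/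

section Classification

open Polynomial

variable {k : Type u} [Field k] {q : k}

theorem monomialOf_mul_sim {R : Type*} [Ring R] [Algebra k R] {e y : R} {v : Rˣ} {ε : ℤ}
    (h : IsQuantumSpace q ε e y v) (hq0 : q ≠ 0) (s t : ℤ × ℕ × ℕ) :
    QSim q (monomialOf e y v s * monomialOf e y v t) (monomialOf e y v (s + t)) := by
  obtain ⟨n, b, a⟩ := s
  obtain ⟨n', b', a'⟩ := t
  simp only [monomialOf, Prod.mk_add_mk]
  have h1 : QComm q _ (y ^ b * e ^ a) (v ^ n' : Rˣ) :=
    ((h.y_v.pow_left hq0 b).mul_left hq0 ((h.e_v.pow_left hq0 a).congr rfl)).zpow_right hq0 n'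
  have h2 := (h.e_y.pow_left hq0 a).pow_right hq0 b'
  rw [zpow_add, Units.val_mul, pow_add, pow_add]
  exact (h1.mul_mul_mul_sim hq0).trans hq0 ((h2.mul_mul_mul_sim hq0).mul_left hq0 _)

/-- Irreducible representations on which `E`, `Y`, `K` generate a quantum space have algebraic
central character. -/
theorem IsIrreducibleRep.exists_aeval_z_eq_zero (hq0 : q ≠ 0) {V : Type*} [AddCommGroup V]
    [Module k V] {ρ : Alg q →ₐ[k] Module.End k V} (hρ : IsIrreducibleRep ρ) {ε : ℤ}
    (h : IsQuantumSpace q ε (ρ (E q)) (ρ (Y q)) (mapK ρ)) :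
    ∃ f : k[X], f ≠ 0 ∧ aeval (zOf ε (ρ (E q)) (ρ (Y q)) (mapK ρ)) f = 0 := by
  have _ := hρ.1
  -- The Nullstellensatz requires natural exponents, so `K` and `K⁻¹` count as two variables and the
  -- exponent of `K` is a difference.
  let idx : Lex (Fin 4 → ℕ) → ℤ × ℕ × ℕ := fun α =>
    ((ofLex α 0 : ℤ) - ofLex α 1, ofLex α 2, ofLex α 3)
  have hidx : ∀ α β, idx (α + β) = idx α + idx β := by
    intro α β
    simp only [idx, ofLex_add, Pi.add_apply, Prod.mk_add_mk, Nat.cast_add]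
    congr 1
    ring
  refine exists_aeval_eq_zero_of_irreducible
    (fun α => monomialOf (ρ (E q)) (ρ (Y q)) (mapK ρ) (idx α)) ?_ ?_ _ ?_ ?_
  · intro γ β
    obtain ⟨i, hi⟩ := monomialOf_mul_sim h hq0 (idx γ) (idx β)
    refine ⟨Units.mk0 (q ^ i) (zpow_ne_zero _ hq0), ?_⟩
    rw [hi, hidx]
    rfl
  · have h0 : idx 0 = (0, 0, 0) := rfl
    rw [h0]
    simp [monomialOf]
  · intro α
    have h1 : QComm q 0 (zOf ε (ρ (E q)) (ρ (Y q)) (mapK ρ))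
        (monomialOf (ρ (E q)) (ρ (Y q)) (mapK ρ) (idx α)) :=
      ((((h.v_z hq0).symm hq0).zpow_right hq0 _).mul_right hq0
        ((((h.y_z hq0).symm hq0).pow_right hq0 _).mul_right hq0
          (((h.e_z hq0).symm hq0).pow_right hq0 _))).congr (by ring)
    unfold QComm at h1
    rw [zpow_zero, one_smul] at h1
    exact h1
  · intro N hN
    refine hρ.2 N ?_
    let S : Submodule k (Alg q) :=
      { carrier := {a | ∀ w ∈ N, ρ a w ∈ N}
        zero_mem' := fun w _ => by simp
        add_mem' := fun {a b} ha hb w hw => by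
          rw [map_add, LinearMap.add_apply]
          exact N.add_mem (ha w hw) (hb w hw)
        smul_mem' := fun t a ha w hw => by
          rw [map_smul, LinearMap.smul_apply]
          exact N.smul_mem _ (ha w hw) }
    have key : ∀ (g : Alg q) (α : Fin 4 → ℕ),
        ρ g = monomialOf (ρ (E q)) (ρ (Y q)) (mapK ρ) (idx (toLex α)) → ∀ a ∈ S, g * a ∈ S := by
      intro g α hg a ha w hw
      rw [map_mul, Module.End.mul_apply, hg]
      exact hN _ _ (ha w hw)
    have htop : S = ⊤ := submodule_eq_top_of_mul_mem S (fun w hw => by simpa using hw)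
      (key _ ![0, 0, 0, 1] (by simp [idx, monomialOf]))
      (key _ ![0, 0, 1, 0] (by simp [idx, monomialOf]))
      (key _ ![1, 0, 0, 0] (by simp [idx, monomialOf]))
      (key _ ![0, 1, 0, 0] (by simp [idx, monomialOf]))
    intro a
    exact (htop ▸ Submodule.mem_top : a ∈ S)

/-- A primitive ideal containing `Y` and `E` is maximal. -/
theorem isCoatom_of_Y_mem_of_E_mem {P : TwoSidedIdeal (Alg q)}
    (hP : IsPrimitiveIdeal P) (hY : Y q ∈ P) (hE : E q ∈ P) : IsCoatom P := by
  obtain ⟨V, _, _, ρ, hρ, hPρ⟩ := hP.exists_rep (k := k)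
  have _ := hρ.1
  have hY0 := (hPρ _).1 hY
  have hE0 := (hPρ _).1 hE
  have hcomm : ∀ a b, ρ a * ρ b = ρ b * ρ a := by
    have key : ∀ r : Module.End k V, Commute r (mapK ρ : Module.End k V) → ∀ a, r * ρ a = ρ a * r := by
      intro r hr a
      let S : Submodule k (Alg q) :=
        { carrier := {a | r * ρ a = ρ a * r}
          zero_mem' := by simp
          add_mem' := by
            intro a b ha hb
            change r * ρ (a + b) = ρ (a + b) * r
            rw [map_add, mul_add, add_mul, ha, hb]
          smul_mem' := by
            intro t a ha
            change r * ρ (t • a) = ρ (t • a) * r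
            rw [map_smul, mul_smul_comm, smul_mul_assoc, ha] }
      have hS : ∀ g, r * ρ g = ρ g * r → ∀ a ∈ S, g * a ∈ S := by
        intro g hg a ha
        change r * ρ (g * a) = ρ (g * a) * r
        rw [map_mul, ← mul_assoc, hg, mul_assoc, ha, mul_assoc]
      have htop : S = ⊤ := submodule_eq_top_of_mul_mem S (by change _ = _; simp)
        (hS _ (by simp [hE0])) (hS _ (by simp [hY0])) (hS _ hr.eq)
        (hS _ (hr.units_inv_right).eq)
      exact (htop ▸ Submodule.mem_top : a ∈ S)
    intro a b
    exact key _ (key _ (Commute.refl _) a).symm b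
  refine ⟨?_, fun I hI => ?_⟩
  · rintro rfl
    have h1 := (hPρ 1).1 trivial
    rw [map_one] at h1
    exact one_ne_zero h1
  · obtain ⟨a, haI, haP⟩ := SetLike.exists_of_lt hI
    obtain ⟨w, hw⟩ : ∃ w, ρ a w ≠ 0 := by
      by_contra! h0
      exact haP ((hPρ a).2 (LinearMap.ext h0))
    let N : Submodule k V := LinearMap.range ((LinearMap.applyₗ (ρ a w)).comp ρ.toLinearMap)
    have hN : N = ⊤ := by
      refine (hρ.2 N ?_).resolve_left fun h0 => ?_
      · rintro r _ ⟨s, rfl⟩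
        refine ⟨r * s, ?_⟩
        change ρ (r * s) (ρ a w) = ρ r (ρ s (ρ a w))
        rw [map_mul, Module.End.mul_apply]
      · refine hw ((Submodule.eq_bot_iff N).1 h0 _ ⟨1, ?_⟩)
        change ρ 1 (ρ a w) = ρ a w
        rw [map_one, Module.End.one_apply]
    obtain ⟨s, hs⟩ : w ∈ N := hN ▸ Submodule.mem_top
    change ρ s (ρ a w) = w at hs
    -- The image of `ρ` is commutative, so this kernel is a subrepresentation; it contains `w ≠ 0`.
    have hker : LinearMap.ker (ρ (1 - s * a)) = ⊤ := by
      refine (hρ.2 _ ?_).resolve_left fun h0 => hw ?_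
      · intro b u hu
        rw [LinearMap.mem_ker] at hu ⊢
        rw [← Module.End.mul_apply, hcomm, Module.End.mul_apply, hu, map_zero]
      · have : w ∈ LinearMap.ker (ρ (1 - s * a)) := by
          rw [LinearMap.mem_ker, map_sub, map_mul, map_one, LinearMap.sub_apply,
            Module.End.mul_apply, hs, Module.End.one_apply, sub_self]
        rw [h0, Submodule.mem_bot] at this
        rw [this, map_zero]
    have h1 : 1 - s * a ∈ I := hI.le ((hPρ _).2 (LinearMap.ker_eq_top.1 hker))
    rw [← TwoSidedIdeal.one_mem_iff]
    simpa using I.add_mem h1 (I.mul_mem_left s _ haI)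

/-- A primitive ideal modulo which `E`, `Y`, `K` generate a quantum space, and which contains
neither `E` nor `Y`, is maximal. -/
theorem isCoatom_of_isQuantumSpace (hq0 : q ≠ 0) (hq : ∀ n : ℕ, 0 < n → q ^ n ≠ 1)
    {P : TwoSidedIdeal (Alg q)} (hP : IsPrimitiveIdeal P) (ε : ℤ)
    (hspace : ∀ {R : Type u} [Ring R] [Algebra k R] (π : Alg q →ₐ[k] R), (∀ a ∈ P, π a = 0) →
      IsQuantumSpace q ε (π (E q)) (π (Y q)) (mapK π))
    (hE : E q ∉ P) (hY : Y q ∉ P) : IsCoatom P := by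
  classical
  obtain ⟨R, _, _, π, hπ, hker⟩ := exists_algHom_ker (k := k) P
  have hR := hP.eq_zero_or_eq_zero π hπ hker
  have h := hspace π fun a ha => (hker a).2 ha
  set e := π (E q) with he
  set y := π (Y q) with hy
  set v := mapK π with hv
  set z := zOf ε e y v with hz
  have he0 : e ≠ 0 := fun h0 => hE ((hker _).1 h0)
  have hy0 : y ≠ 0 := fun h0 => hY ((hker _).1 h0)
  have hregY : ∀ {b : R}, b ≠ 0 → ∀ i : ℕ, y ^ i * b ≠ 0 ∧ b * y ^ i ≠ 0 := fun hb i =>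
    pow_mul_ne_zero_of_qComm hq0 π hπ hR (h.e_y.symm hq0) (QComm.refl y) h.y_v hy0 hb i
  have hz0 : z ≠ 0 := by
    intro h0
    exact (hregY he0 2).1 ((v ^ ε).isUnit.mul_right_eq_zero.1 h0)
  -- The relation is found on a simple module with annihilator `P` and transfers to the quotient
  -- `R`, since both maps have kernel `P`.
  obtain ⟨f, hf0, hf⟩ : ∃ f : k[X], f ≠ 0 ∧ aeval z f = 0 := by
    obtain ⟨V, _, _, ρ, hρ, hPρ⟩ := hP.exists_rep (k := k)
    obtain ⟨f, hf0, hf⟩ := hρ.exists_aeval_z_eq_zero hq0 (hspace ρ fun a ha => (hPρ a).1 ha)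
    refine ⟨f, hf0, ?_⟩
    rw [hz, he, hy, hv, ← map_zOf π, aeval_algHom_apply, hker, hPρ, ← aeval_algHom_apply, map_zOf ρ, hf]
  have hcomm : ∀ r, Commute z r := by
    intro r
    obtain ⟨a, rfl⟩ := hπ r
    let S : Subalgebra k (Alg q) := (Subalgebra.centralizer k {z}).comap π
    have key : ∀ g : Alg q, QComm q 0 z (π g) → ∀ a ∈ Subalgebra.toSubmodule S,
        g * a ∈ Subalgebra.toSubmodule S := by
      intro g hg a ha
      refine S.mul_mem ?_ ha
      unfold QComm at hg
      rw [zpow_zero, one_smul] at hg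
      change π g ∈ Subalgebra.centralizer k {z}
      rw [Subalgebra.mem_centralizer_iff]
      rintro _ rfl
      exact hg
    have hv0 : QComm q 0 z (v : R) := (h.v_z hq0).symm hq0
    have htop := submodule_eq_top_of_mul_mem (Subalgebra.toSubmodule S) S.one_mem
      (key _ ((h.e_z hq0).symm hq0)) (key _ ((h.y_z hq0).symm hq0)) (key _ hv0)
      (key _ ((hv0.inv_right hq0).congr neg_zero))
    have ha : a ∈ Subalgebra.toSubmodule S := htop ▸ Submodule.mem_top
    exact (Subalgebra.mem_centralizer_iff k).1 ha z rfl
  have hcomm' : ∀ (p : k[X]) r, aeval z p * r = r * aeval z p := by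
    intro p r
    induction p using Polynomial.induction_on' with
    | add p p' hp hp' => rw [map_add, add_mul, mul_add, hp, hp']
    | monomial n t =>
      rw [aeval_monomial, mul_assoc, ((hcomm r).pow_left n).eq, ← mul_assoc, ← mul_assoc,
        Algebra.commutes]
  have h10 : (1 : R) ≠ 0 := fun h0 => he0 (by rw [← mul_one e, h0, mul_zero])
  -- The kernel of evaluation at `z` is prime because `R` is a prime ring and `z` is central, and
  -- nonzero because `z` is algebraic. In `k[X]` it is therefore maximal.
  have hinv : ∀ p : k[X], aeval z p ≠ 0 → ∃ p' : k[X], aeval z p * aeval z p' = 1 := by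
    intro p hp
    let Q : Ideal k[X] := RingHom.ker (aeval z : k[X] →ₐ[k] R)
    have hQ : Q.IsPrime := by
      refine ⟨fun h0 => h10 ?_, fun {p p'} hpp => ?_⟩
      · have : (1 : k[X]) ∈ Q := h0 ▸ Submodule.mem_top
        simp only [Q, RingHom.mem_ker, map_one] at this
        exact this
      · simp only [Q, RingHom.mem_ker] at hpp ⊢
        refine hR _ _ fun r => ?_
        rw [hcomm', mul_assoc, ← map_mul, hpp, mul_zero]
    have hQmax : Q.IsMaximal := hQ.isMaximal fun h0 => hf0 (by
      rw [← Ideal.mem_bot, ← h0]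
      exact hf)
    obtain ⟨p', i, hi, hpi⟩ := hQmax.exists_inv (x := p) hp
    refine ⟨p', ?_⟩
    have := congrArg (aeval z) hpi
    rw [map_add, map_mul, map_one, (hi : aeval z i = 0), add_zero] at this
    rw [hcomm', this]
  refine ⟨?_, fun I hI => ?_⟩
  · rintro rfl
    exact hE trivial
  · obtain ⟨a, haI, haP⟩ := SetLike.exists_of_lt hI
    obtain ⟨J, hJ⟩ := exists_twoSidedIdeal_map π.toRingHom hπ I fun b hb => hI.le ((hker b).1 hb)
    have haJ : π a ∈ J := (hJ a).2 haI
    have ha0 : π a ≠ 0 := fun h0 => haP ((hker a).1 h0)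
    obtain ⟨c, hc⟩ := exists_finsupp_monomial_sum hq0 π h a
    obtain ⟨μ, hμ⟩ : ∃ μ, ∑ s ∈ c.support with weightOf ε s = μ, c s • monomialOf e y v s ≠ 0 := by
      by_contra! h0
      refine ha0 ?_
      rw [← hc, Finsupp.sum, ← Finset.sum_fiberwise_of_maps_to
        (t := c.support.image (weightOf ε)) (g := weightOf ε)
        (fun s hs => Finset.mem_image_of_mem _ hs)]
      exact Finset.sum_eq_zero fun μ _ => h0 μ
    obtain ⟨p, d, N, n, h1, -, h2⟩ := h.exists_polynomial hq0 hq J c (by rw [hc]; exact haJ) μ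
    have hp : aeval z p ≠ 0 := by
      intro h0
      rw [← hz, h0, mul_zero] at h1
      refine (hregY ?_ N).2 h1
      exact fun h3 => hμ ((v ^ n).isUnit.mul_right_eq_zero.1 h3)
    obtain ⟨p', hp'⟩ := hinv p hp
    have hyd : y ^ d ∈ J := by
      have := J.mul_mem_right _ (aeval z p') h2
      rwa [mul_assoc, ← hz, hp', mul_one] at this
    -- The central element is a unit, and `z^d` contains the factor `y^(2d)` up to units and powers
    -- of `q`, so `y^d ∈ J` forces `1 ∈ J`.
    obtain ⟨w, hw⟩ := hinv Polynomial.X (by rwa [aeval_X])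
    rw [aeval_X] at hw
    have hzd : z ^ d ∈ J := by
      rw [(h.z_pow_sim hq0 d).mem_iff hq0, unit_mul_mem_iff, two_mul, pow_add, mul_assoc]
      exact J.mul_mem_right _ _ hyd
    have h1J : (1 : R) ∈ J := by
      have := J.mul_mem_right _ (aeval z w ^ d) hzd
      rwa [← (hcomm _).mul_pow, hw, one_pow] at this
    rw [← TwoSidedIdeal.one_mem_iff, ← hJ]
    simpa using h1J

theorem isCoatom_of_X_mem (hq0 : q ≠ 0) (hq : ∀ n : ℕ, 0 < n → q ^ n ≠ 1)
    {P : TwoSidedIdeal (Alg q)} (hP : IsPrimitiveIdeal P) (hX : X q ∈ P) (hE : E q ∉ P)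
    (hY : Y q ∉ P) : IsCoatom P :=
  isCoatom_of_isQuantumSpace hq0 hq hP (-1) (fun π hπ => isQuantumSpace_of_X π (hπ _ hX)) hE hY

theorem isCoatom_of_phi_mem (hq0 : q ≠ 0) (hq : ∀ n : ℕ, 0 < n → q ^ n ≠ 1)
    {P : TwoSidedIdeal (Alg q)} (hP : IsPrimitiveIdeal P) (hphi : phi q ∈ P) (hE : E q ∉ P)
    (hY : Y q ∉ P) : IsCoatom P :=
  isCoatom_of_isQuantumSpace hq0 hq hP 1 (fun π hπ => isQuantumSpace_of_phi π (hπ _ hphi)) hE hY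

/-- A nonzero primitive ideal contains `X` or `φ`. -/
theorem X_mem_or_phi_mem (hq0 : q ≠ 0) (hq : ∀ n : ℕ, 0 < n → q ^ n ≠ 1)
    {P : TwoSidedIdeal (Alg q)} (hP : IsPrimitiveIdeal P) (hne : P ≠ ⊥) :
    X q ∈ P ∨ phi q ∈ P := by
  obtain ⟨R, _, _, π, hπ, hker⟩ := exists_algHom_ker (k := k) P
  have hR := hP.eq_zero_or_eq_zero π hπ hker
  have h := isAgeing_map π
  obtain ⟨a, ha, ha0⟩ : ∃ a ∈ P, a ≠ 0 := by
    by_contra! h0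
    exact hne (eq_bot_iff.2 fun a ha => by rw [TwoSidedIdeal.mem_bot]; exact h0 a ha)
  obtain ⟨i, j, hij⟩ := exists_X_pow_mul_phi_pow_mem hq0 hq P ha ha0
  by_contra! hcon
  rw [← hker, ← hker] at hcon
  rw [← hker, map_mul, map_pow, map_pow] at hij
  have h10 : (1 : R) ≠ 0 := fun h0 => hcon.1 (by rw [← mul_one (π (X q)), h0, mul_zero])
  rw [map_phi] at hij hcon
  refine (pow_mul_ne_zero_of_qComm hq0 π hπ hR (h.e_x.symm hq0) h.x_y h.x_v hcon.1 ?_ i).1 hij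
  have := (pow_mul_ne_zero_of_qComm hq0 π hπ hR (h.e_phi.symm hq0) h.phi_y (h.phi_v hq0) hcon.2
    h10 j).1
  rwa [mul_one] at this

theorem X_mem_of_Y_mem {P : TwoSidedIdeal (Alg q)} (hY : Y q ∈ P) : X q ∈ P := by
  rw [eq_sub_of_add_eq (isAgeing_alg q).e_mul_y.symm]
  exact P.sub_mem (P.mul_mem_left _ _ hY) (smul_mem _ (P.mul_mem_right _ _ hY))

theorem X_mem_of_E_mem {P : TwoSidedIdeal (Alg q)} (hE : E q ∈ P) : X q ∈ P := by
  rw [eq_sub_of_add_eq (isAgeing_alg q).e_mul_y.symm]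
  exact P.sub_mem (P.mul_mem_right _ _ hE) (smul_mem _ (P.mul_mem_left _ _ hE))

/-- If modulo `P` the algebra is generated by `K` and a `q`-commuting element `g`, then ideals
properly containing `P` contain powers of `g`. -/
theorem exists_pow_mem_of_lt (hq0 : q ≠ 0) (hq : ∀ n : ℕ, 0 < n → q ^ n ≠ 1)
    {P I : TwoSidedIdeal (Alg q)} (hlt : P < I) {g : Alg q} {d : ℤ} (hd : d ≠ 0)
    (hg : QComm q d g (K q : Alg q)) (hE : E q ∈ P ∨ E q = g) (hY : Y q ∈ P ∨ Y q = g) :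
    ∃ j : ℕ, g ^ j ∈ I := by
  obtain ⟨R, _, _, π, hπ, hker⟩ := exists_algHom_ker (k := k) P
  obtain ⟨a, haI, haP⟩ := SetLike.exists_of_lt hlt
  obtain ⟨J, hJ⟩ := exists_twoSidedIdeal_map π.toRingHom hπ I fun b hb => hlt.le ((hker b).1 hb)
  obtain ⟨c, hc⟩ := exists_finsupp_pow_sum hq0 π (hg.map π)
    (hE.imp (hker _).2 (congrArg π)) (hY.imp (hker _).2 (congrArg π)) a
  obtain ⟨j, hj⟩ := exists_pow_mem_of_sum_mem hq0 hq hd (v := mapK π) (hg.map π) J c (by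
    rintro rfl
    exact haP ((hker a).1 (by simpa using hc.symm))) (by
    rw [hc]
    exact (hJ a).2 haI)
  refine ⟨j, (hJ _).1 ?_⟩
  change π (g ^ j) ∈ J
  rwa [map_pow]

/-- A primitive ideal properly containing `(Y)` contains `E`. -/
theorem E_mem_of_span_Y_lt (hq0 : q ≠ 0) (hq : ∀ n : ℕ, 0 < n → q ^ n ≠ 1)
    {P : TwoSidedIdeal (Alg q)} (hP : IsPrimitiveIdeal P) (hlt : TwoSidedIdeal.span {Y q} < P) :
    E q ∈ P := by
  have hYs : Y q ∈ TwoSidedIdeal.span {Y q} := TwoSidedIdeal.subset_span rfl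
  obtain ⟨j, hj⟩ := exists_pow_mem_of_lt hq0 hq hlt (by norm_num) (isAgeing_alg q).e_v
    (Or.inr rfl) (Or.inl hYs)
  obtain ⟨R, _, _, π, hπ, hker⟩ := exists_algHom_ker (k := k) P
  have h := isQuantumSpace_of_X π ((hker _).2 (X_mem_of_Y_mem (hlt.le hYs)))
  by_contra hE
  rw [← hker] at hE hj
  refine (pow_mul_ne_zero_of_qComm hq0 π hπ (hP.eq_zero_or_eq_zero π hπ hker) (QComm.refl _)
    h.e_y h.e_v hE (b := 1) (fun h0 => hE ?_) j).1 ?_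
  · rw [← mul_one (π (E q)), h0, mul_zero]
  · rwa [mul_one, ← map_pow]

/-- A primitive ideal properly containing `(E)` contains `Y`. -/
theorem Y_mem_of_span_E_lt (hq0 : q ≠ 0) (hq : ∀ n : ℕ, 0 < n → q ^ n ≠ 1)
    {P : TwoSidedIdeal (Alg q)} (hP : IsPrimitiveIdeal P) (hlt : TwoSidedIdeal.span {E q} < P) :
    Y q ∈ P := by
  have hEs : E q ∈ TwoSidedIdeal.span {E q} := TwoSidedIdeal.subset_span rfl
  obtain ⟨j, hj⟩ := exists_pow_mem_of_lt hq0 hq hlt (by norm_num) (isAgeing_alg q).y_v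
    (Or.inl hEs) (Or.inr rfl)
  obtain ⟨R, _, _, π, hπ, hker⟩ := exists_algHom_ker (k := k) P
  have h := isQuantumSpace_of_X π ((hker _).2 (X_mem_of_E_mem (hlt.le hEs)))
  by_contra hY
  rw [← hker] at hY hj
  refine (pow_mul_ne_zero_of_qComm hq0 π hπ (hP.eq_zero_or_eq_zero π hπ hker)
    (h.e_y.symm hq0) (QComm.refl _) h.y_v hY (b := 1) (fun h0 => hY ?_) j).1 ?_
  · rw [← mul_one (π (Y q)), h0, mul_zero]
  · rwa [mul_one, ← map_pow]

/-- Every primitive ideal is maximal or one of `(Y)`, `(E)`, `0`. -/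
theorem IsPrimitiveIdeal.isCoatom_or (hq0 : q ≠ 0) (hq : ∀ n : ℕ, 0 < n → q ^ n ≠ 1)
    {P : TwoSidedIdeal (Alg q)} (hP : IsPrimitiveIdeal P) :
    IsCoatom P ∨ P = TwoSidedIdeal.span {Y q} ∨ P = TwoSidedIdeal.span {E q} ∨ P = ⊥ := by
  by_contra! hne
  obtain ⟨hmax, hneY, hneE, hne0⟩ := hne
  by_cases hY : Y q ∈ P
  · have hE := E_mem_of_span_Y_lt hq0 hq hP
      (lt_of_le_of_ne (TwoSidedIdeal.span_le.2 (Set.singleton_subset_iff.2 hY)) hneY.symm)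
    exact hmax (isCoatom_of_Y_mem_of_E_mem hP hY hE)
  by_cases hE : E q ∈ P
  · have hY := Y_mem_of_span_E_lt hq0 hq hP
      (lt_of_le_of_ne (TwoSidedIdeal.span_le.2 (Set.singleton_subset_iff.2 hE)) hneE.symm)
    exact hmax (isCoatom_of_Y_mem_of_E_mem hP hY hE)
  rcases X_mem_or_phi_mem hq0 hq hP hne0 with hX | hphi
  · exact hmax (isCoatom_of_X_mem hq0 hq hP hX hE hY)
  · exact hmax (isCoatom_of_phi_mem hq0 hq hP hphi hE hY)

/-- Maximal two-sided ideals are primitive. -/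
theorem isPrimitiveIdeal_of_isCoatom {R : Type u} [Ring R] {P : TwoSidedIdeal R}
    (hP : IsCoatom P) : IsPrimitiveIdeal P := by
  have hne : P.asIdeal ≠ ⊤ := by
    intro h
    refine hP.1 ((TwoSidedIdeal.one_mem_iff P).1 ?_)
    rw [← TwoSidedIdeal.mem_asIdeal, h]
    trivial
  -- For a maximal left ideal `m` containing `P`, the annihilator of `R ⧸ m` is a proper two-sided
  -- ideal containing `P`, hence equal to `P`.
  obtain ⟨m, hm, hle⟩ := Ideal.exists_le_maximal _ hne
  have hsimple : IsSimpleModule R (R ⧸ m) := isSimpleModule_iff_isCoatom.2 hm.out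
  refine ⟨R ⧸ m, inferInstance, inferInstance, hsimple, ?_⟩
  have _ := IsSimpleModule.nontrivial R (R ⧸ m)
  set Q := (Module.annihilator R (R ⧸ m)).toTwoSided with hQ
  have hPQ : P ≤ Q := by
    intro a ha
    rw [hQ, Ideal.mem_toTwoSided, Module.mem_annihilator]
    intro w
    obtain ⟨r, rfl⟩ := Submodule.Quotient.mk_surjective m w
    rw [← Submodule.Quotient.mk_smul, Submodule.Quotient.mk_eq_zero]
    exact hle (P.mul_mem_right _ _ ha)
  have hQtop : Q ≠ ⊤ := by
    intro h
    have h1 : (1 : R) ∈ Q := h ▸ trivial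
    rw [hQ, Ideal.mem_toTwoSided, Module.mem_annihilator] at h1
    obtain ⟨w, hw⟩ := exists_ne (0 : R ⧸ m)
    exact hw (by simpa using h1 w)
  have hPQ' : P = Q := by
    by_contra h
    exact hQtop (hP.2 Q (lt_of_le_of_ne hPQ h))
  rw [hPQ', hQ]
  ext a
  simp

end Classification

/-! ### Diagonal and shift operators on finitely supported functions -/

section Operators

variable {ι k B : Type*} [Field k] [CommRing B] [Algebra k B]

/-- The invertible operator on finitely supported functions which scales the basis vector at `s` by
the unit `w s`. -/
noncomputable def diagOp (w : ι → Bˣ) : (Module.End B (ι →₀ B))ˣ where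
  val := Finsupp.lsum B fun s => (w s : B) • Finsupp.lsingle s
  inv := Finsupp.lsum B fun s => ((w s)⁻¹ : Bˣ).val • Finsupp.lsingle s
  val_inv := by
    ext s : 2
    simp
  inv_val := by
    ext s : 2
    simp

/-- The invertible operator on finitely supported functions which permutes the basis vectors. -/
noncomputable def shiftOp (B : Type*) [CommRing B] (σ : Equiv.Perm ι) :
    (Module.End B (ι →₀ B))ˣ where
  val := Finsupp.lmapDomain B B σ
  inv := Finsupp.lmapDomain B B σ.symm
  val_inv := by
    ext s : 2
    simp
  inv_val := by
    ext s : 2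
    simp

@[simp]
theorem diagOp_single (w : ι → Bˣ) (s : ι) (b : B) :
    (diagOp w : Module.End B (ι →₀ B)) (Finsupp.single s b) = Finsupp.single s (w s * b) := by
  simp [diagOp]

@[simp]
theorem shiftOp_single (σ : Equiv.Perm ι) (s : ι) (b : B) :
    (shiftOp B σ : Module.End B (ι →₀ B)) (Finsupp.single s b) = Finsupp.single (σ s) b := by
  simp [shiftOp]

@[simp]
theorem shiftOp_inv_single (σ : Equiv.Perm ι) (s : ι) (b : B) :
    ((shiftOp B σ)⁻¹ : (Module.End B (ι →₀ B))ˣ).val (Finsupp.single s b)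
      = Finsupp.single (σ.symm s) b := by
  change Finsupp.lmapDomain B B σ.symm (Finsupp.single s b) = _
  simp

theorem diagOp_shiftOp {q : k} {n : ℤ} (w : ι → Bˣ) (σ : Equiv.Perm ι)
    (h : ∀ s, (w (σ s) : B) = q ^ n • (w s : B)) :
    QComm q n (diagOp w : Module.End B (ι →₀ B)) (shiftOp B σ : Module.End B (ι →₀ B)) := by
  unfold QComm
  ext s : 2
  simp [h]

theorem diagOp_diagOp (q : k) (w w' : ι → Bˣ) :
    QComm q 0 (diagOp w : Module.End B (ι →₀ B)) (diagOp w' : Module.End B (ι →₀ B)) := by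
  unfold QComm
  ext s : 2
  simp [mul_comm]

theorem shiftOp_shiftOp (q : k) (σ τ : Equiv.Perm ι) (h : ∀ s, σ (τ s) = τ (σ s)) :
    QComm q 0 (shiftOp B σ : Module.End B (ι →₀ B)) (shiftOp B τ : Module.End B (ι →₀ B)) := by
  unfold QComm
  ext s : 2
  simp [h]

/-- Joint eigenvalues separate the basis vectors: for `s ≠ t` in the support of `f`, a suitable `D i
f - l i s • f` loses `s`, keeps `t`, and acquires no new support. -/
theorem exists_single_mem_of_diag {κ : Type*} (D : κ → Module.End k (ι →₀ k)) (l : κ → ι → k)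
    (hD : ∀ i s b, D i (Finsupp.single s b) = Finsupp.single s (l i s * b))
    (hl : ∀ s t, s ≠ t → ∃ i, l i s ≠ l i t) (N : Submodule k (ι →₀ k))
    (hN : ∀ i, ∀ f ∈ N, D i f ∈ N) (hne : N ≠ ⊥) : ∃ s, Finsupp.single s 1 ∈ N := by
  classical
  have happ : ∀ i f s, D i f s = l i s * f s := by
    intro i f s
    induction f using Finsupp.induction_linear with
    | zero => simp
    | add f g hf hg => rw [map_add, Finsupp.add_apply, hf, hg, Finsupp.add_apply, mul_add]
    | single t b =>
      rw [hD, Finsupp.single_apply, Finsupp.single_apply]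
      split_ifs with h
      · rw [h]
      · rw [mul_zero]
  obtain ⟨f, hf, hf0⟩ := N.ne_bot_iff.1 hne
  induction hc : f.support.card using Nat.strong_induction_on generalizing f with
  | _ c ih =>
  obtain ⟨s, hs⟩ := Finsupp.support_nonempty_iff.2 hf0
  by_cases hall : ∀ t ∈ f.support, t = s
  · have hfs : f = Finsupp.single s (f s) := by
      ext t
      rw [Finsupp.single_apply]
      split_ifs with h
      · rw [h]
      · by_contra h0
        exact h (hall t (Finsupp.mem_support_iff.2 h0)).symm
    refine ⟨s, ?_⟩
    have := N.smul_mem (f s)⁻¹ hf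
    rw [hfs, Finsupp.smul_single, smul_eq_mul, Finsupp.single_eq_same,
      inv_mul_cancel₀ (Finsupp.mem_support_iff.1 hs)] at this
    exact this
  · push Not at hall
    obtain ⟨t, ht, hts⟩ := hall
    obtain ⟨i, hi⟩ := hl t s hts
    have hg : ∀ r, (D i f - l i s • f) r = (l i r - l i s) * f r := by
      intro r
      rw [Finsupp.sub_apply, happ, Finsupp.smul_apply, smul_eq_mul, sub_mul]
    refine ih _ ?_ (D i f - l i s • f) (N.sub_mem (hN i f hf) (N.smul_mem _ hf)) ?_ rfl
    · rw [← hc]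
      refine Finset.card_lt_card (Finset.ssubset_iff_subset_ne.2 ⟨fun r hr => ?_, fun h => ?_⟩)
      · rw [Finsupp.mem_support_iff, hg] at hr
        exact Finsupp.mem_support_iff.2 (right_ne_zero_of_mul hr)
      · rw [← h, Finsupp.mem_support_iff, hg, sub_self, zero_mul] at hs
        exact hs rfl
    · intro h0
      have := hg t
      rw [h0, Finsupp.zero_apply] at this
      exact mul_ne_zero (sub_ne_zero.2 hi) (Finsupp.mem_support_iff.1 ht) this.symm

theorem eq_top_of_single_mem (N : Submodule k (ι →₀ k)) (h : ∀ s, Finsupp.single s 1 ∈ N) :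
    N = ⊤ := by
  refine eq_top_iff.2 fun f _ => ?_
  rw [← f.sum_single]
  refine N.sum_mem fun s _ => ?_
  have := N.smul_mem (f s) (h s)
  rwa [Finsupp.smul_single, smul_eq_mul, mul_one] at this

end Operators

/-! ### Primeness of `(X)`, `(φ)` and `(Y, E)` -/

section Primes

open Polynomial LaurentPolynomial

/-- An ideal is prime if it avoids a submonoid which meets all strictly larger ideals. -/
theorem isPrimeIdeal_of_submonoid {R : Type u} [Ring R] (P : TwoSidedIdeal R) (T : Submonoid R)
    (hT : ∀ a ∈ T, a ∉ P) (hI : ∀ I : TwoSidedIdeal R, P < I → ∃ a ∈ T, a ∈ I) :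
    IsPrimeIdeal P := by
  refine ⟨fun h => hT 1 T.one_mem (h ▸ trivial), fun I J hIJ => ?_⟩
  by_contra! hcon
  obtain ⟨a, haT, ha⟩ := hI (I ⊔ P) (right_lt_sup.2 hcon.1)
  obtain ⟨b, hbT, hb⟩ := hI (J ⊔ P) (right_lt_sup.2 hcon.2)
  obtain ⟨i, hi, p, hp, rfl⟩ := TwoSidedIdeal.mem_sup.1 ha
  obtain ⟨j, hj, p', hp', rfl⟩ := TwoSidedIdeal.mem_sup.1 hb
  refine hT _ (T.mul_mem haT hbT) ?_
  rw [add_mul, mul_add]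
  exact P.add_mem (P.add_mem (hIJ i hi j hj) (P.mul_mem_left _ _ hp')) (P.mul_mem_right _ _ hp)

variable {k : Type u} [Field k] {q : k}

theorem qComm_zero_right {R : Type*} [Ring R] [Algebra k R] (n : ℤ) (a : R) : QComm q n a 0 := by
  simp [QComm]

theorem qComm_zero_left {R : Type*} [Ring R] [Algebra k R] (n : ℤ) (a : R) : QComm q n 0 a := by
  simp [QComm]

theorem IsQuantumSpace.isAgeing_of_neg_one {R : Type*} [Ring R] [Algebra k R] {e y : R} {v : Rˣ}
    (h : IsQuantumSpace q (-1) e y v) : IsAgeing q e 0 y v where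
  e_v := h.e_v
  x_v := qComm_zero_left _ _
  y_v := h.y_v
  e_x := qComm_zero_right _ _
  x_y := qComm_zero_left _ _
  e_mul_y := by
    have := h.e_y
    unfold QComm at this
    rwa [zero_add, ← zpow_neg_one]

/-- The value of `X` is forced: `EY = qYE` gives `X = EY - q⁻¹YE = (q - q⁻¹)YE`. -/
theorem IsQuantumSpace.isAgeing_of_one (hq0 : q ≠ 0) {R : Type*} [Ring R] [Algebra k R] {e y : R}
    {v : Rˣ} (h : IsQuantumSpace q 1 e y v) : IsAgeing q e ((q - q⁻¹) • (y * e)) y v where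
  e_v := h.e_v
  x_v := by
    have h1 : QComm q (1 + -2) (y * e) (v : R) := h.y_v.mul_left hq0 h.e_v
    exact (((h1.symm hq0).smul_right _).symm hq0).congr (by ring)
  y_v := h.y_v
  e_x := ((h.e_y.mul_right hq0 (QComm.refl e)).smul_right _).congr (by ring)
  x_y := by
    have h1 : QComm q (0 + 1) (y * e) y := (QComm.refl y).mul_left hq0 h.e_y
    exact (((h1.symm hq0).smul_right _).symm hq0).congr (by ring)
  e_mul_y := by
    have := h.e_y
    unfold QComm at this
    rw [this, ← add_smul, zpow_one, sub_add_cancel]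

/-- The unit `q` of a `k`-algebra. -/
def qUnit (hq0 : q ≠ 0) (B : Type*) [CommRing B] [Algebra k B] : Bˣ :=
  Units.map (algebraMap k B : k →* B) (Units.mk0 q hq0)

theorem qUnit_zpow (hq0 : q ≠ 0) (B : Type*) [CommRing B] [Algebra k B] (n : ℤ) :
    ((qUnit hq0 B ^ n : Bˣ) : B) = algebraMap k B (q ^ n) := by
  rw [qUnit, ← map_zpow, Units.coe_map, Units.val_zpow_eq_zpow_val]
  rfl

theorem qUnit_zpow_add (hq0 : q ≠ 0) (B : Type*) [CommRing B] [Algebra k B] (n m : ℤ) :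
    ((qUnit hq0 B ^ (n + m) : Bˣ) : B) = q ^ n • ((qUnit hq0 B ^ m : Bˣ) : B) := by
  rw [qUnit_zpow, qUnit_zpow, zpow_add₀ hq0, map_mul, Algebra.smul_def]

/-- The diagonal operator `q^(d n)` on functions on `ℤ`. -/
noncomputable def weightOp (hq0 : q ≠ 0) (B : Type*) [CommRing B] [Algebra k B] (d : ℤ) :
    (Module.End B (ℤ →₀ B))ˣ :=
  diagOp fun n => qUnit hq0 B ^ (d * n)

theorem weightOp_shiftOp (hq0 : q ≠ 0) (B : Type*) [CommRing B] [Algebra k B] (d : ℤ) :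
    QComm q d (weightOp hq0 B d : Module.End B (ℤ →₀ B))
      (shiftOp B (Equiv.addLeft (1 : ℤ)) : Module.End B (ℤ →₀ B)) :=
  diagOp_shiftOp _ _ fun s => by
    rw [← qUnit_zpow_add, Equiv.coe_addLeft, mul_add, mul_one]

/-- A quantum space over `k[t]` in which `Y` is invertible and the central element is `t`. -/
theorem exists_isQuantumSpace (hq0 : q ≠ 0) (ε : ℤ) :
    ∃ (e : Module.End k[X] (ℤ →₀ k[X])) (y v : (Module.End k[X] (ℤ →₀ k[X]))ˣ),
      IsQuantumSpace q ε e (y : Module.End k[X] (ℤ →₀ k[X])) v ∧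
      zOf ε e (y : Module.End k[X] (ℤ →₀ k[X])) v = algebraMap k[X] _ Polynomial.X := by
  set w := weightOp hq0 k[X] 1
  set v := shiftOp k[X] (Equiv.addLeft (1 : ℤ))
  have hwv : QComm q 1 (w : Module.End k[X] (ℤ →₀ k[X])) (v : Module.End k[X] (ℤ →₀ k[X])) :=
    weightOp_shiftOp hq0 k[X] 1
  set t := algebraMap k[X] (Module.End k[X] (ℤ →₀ k[X])) Polynomial.X
  have ht : ∀ r, QComm q 0 t r := by
    intro r
    unfold QComm
    rw [zpow_zero, one_smul]
    exact Algebra.commutes _ _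
  -- With `Y = w` and `K = v` invertible, `E` is obtained by solving `K^ε Y²E = t`.
  refine ⟨t * ((w ^ (-2 : ℤ) : Units _) * (v ^ (-ε) : Units _)), w, v, ⟨?_, hwv, ?_⟩, ?_⟩
  · exact ((ht _).mul_left hq0 ((hwv.zpow_left hq0 (-2)).mul_left hq0
      ((QComm.refl _).zpow_left hq0 (-ε)))).congr (by ring)
  · exact ((ht _).mul_left hq0 (((QComm.refl _).zpow_left hq0 (-2)).mul_left hq0
      ((hwv.symm hq0).zpow_left hq0 (-ε)))).congr (by ring)
  · rw [zOf, ← mul_assoc (_ ^ 2), ← mul_assoc (v ^ ε : Units _).val, ← mul_assoc (v ^ ε : Units _).val,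
      show ((v ^ ε : Units _) : Module.End k[X] (ℤ →₀ k[X])) * (w : Module.End k[X] (ℤ →₀ k[X])) ^ 2
        * t = t * ((v ^ ε * w ^ 2 : Units _) : Module.End k[X] (ℤ →₀ k[X])) from by
        rw [Units.val_mul, Units.val_pow_eq_pow_val]
        exact (Algebra.commutes _ _).symm]
    rw [mul_assoc, ← Units.val_mul, ← Units.val_mul]
    have : v ^ ε * w ^ 2 * (w ^ (-2 : ℤ) * v ^ (-ε)) = 1 := by
      rw [← zpow_natCast w 2]
      group
    rw [this, Units.val_one, mul_one]

/-- Criterion for primeness of an ideal modulo which `E`, `Y`, `K` generate a quantum space. -/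
theorem isPrimeIdeal_of_isQuantumSpace (hq0 : q ≠ 0) (hq : ∀ n : ℕ, 0 < n → q ^ n ≠ 1)
    {P : TwoSidedIdeal (Alg q)} (ε : ℤ)
    (hspace : ∀ {R : Type u} [Ring R] [Algebra k R] (π : Alg q →ₐ[k] R), (∀ a ∈ P, π a = 0) →
      IsQuantumSpace q ε (π (E q)) (π (Y q)) (mapK π))
    (ρ : Alg q →ₐ[k] Module.End k[X] (ℤ →₀ k[X])) (hρP : ∀ a ∈ P, ρ a = 0)
    (hρz : ρ (zOf ε (E q) (Y q) (K q)) = algebraMap k[X] _ Polynomial.X)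
    (hρY : IsUnit (ρ (Y q))) : IsPrimeIdeal P := by
  -- Elements acting injectively. They avoid `P`, which acts by zero on a nonzero module; an ideal
  -- above `P` yields `Y^d p(z)`, acting as a unit times multiplication by `p ≠ 0` on a free
  -- `k[X]`-module.
  let T : Submonoid (Alg q) :=
    { carrier := {a | Function.Injective (ρ a)}
      one_mem' := by
        change Function.Injective (ρ 1)
        rw [map_one]
        exact Function.injective_id
      mul_mem' := by
        intro a b ha hb
        change Function.Injective (ρ (a * b))
        rw [map_mul]
        exact fun x y hxy => hb (ha hxy) }
  refine isPrimeIdeal_of_submonoid P T (fun a ha haP => ?_) fun I hI => ?_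
  · have h0 : ρ a (Finsupp.single 0 1) = ρ a 0 := by rw [hρP a haP]; simp
    have := (ha : Function.Injective (ρ a)) h0
    simp at this
  · obtain ⟨R, _, _, π, hπ, hker⟩ := exists_algHom_ker (k := k) P
    have h := hspace π fun a ha => (hker a).2 ha
    obtain ⟨a, haI, haP⟩ := SetLike.exists_of_lt hI
    obtain ⟨J, hJ⟩ := exists_twoSidedIdeal_map π.toRingHom hπ I fun b hb => hI.le ((hker b).1 hb)
    obtain ⟨c, hc⟩ := exists_finsupp_monomial_sum hq0 π h a
    obtain ⟨s, hs⟩ : c.support.Nonempty := by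
      rw [Finsupp.support_nonempty_iff]
      rintro rfl
      exact haP ((hker a).1 (by simpa using hc.symm))
    obtain ⟨p, d, N, n, -, hp, hpJ⟩ := h.exists_polynomial hq0 hq J c (by
      rw [hc]; exact (hJ a).2 haI) (weightOf ε s)
    have hp0 := hp ⟨s, hs, rfl⟩
    refine ⟨Y q ^ d * aeval (zOf ε (E q) (Y q) (K q)) p, ?_, (hJ _).1 ?_⟩
    · change Function.Injective (ρ _)
      rw [map_mul, map_pow, ← aeval_algHom_apply, hρz, aeval_algebraMap_apply, aeval_X_left_apply]
      intro f g hfg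
      have h1 : p • f = p • g := ((Module.End.isUnit_iff _).1 (hρY.pow d)).injective hfg
      exact smul_right_injective _ hp0 h1
    · change π _ ∈ J
      rwa [map_mul, map_pow, ← aeval_algHom_apply, map_zOf]

theorem mapK_eq {R : Type*} [Ring R] [Algebra k R] {ρ : Alg q →ₐ[k] R} {v : Rˣ}
    (h : ρ (K q) = v) : mapK ρ = v :=
  Units.ext h

theorem eq_zero_of_mem_span {R : Type*} [Ring R] [Algebra k R] (ρ : Alg q →ₐ[k] R) {s : Set (Alg q)}
    (h : ∀ a ∈ s, ρ a = 0) : ∀ a ∈ TwoSidedIdeal.span s, ρ a = 0 := by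
  have : TwoSidedIdeal.span s ≤ TwoSidedIdeal.ker ρ.toRingHom :=
    TwoSidedIdeal.span_le.2 fun a ha => (TwoSidedIdeal.mem_ker _).2 (h a ha)
  intro a ha
  exact (TwoSidedIdeal.mem_ker _).1 (this ha)

theorem IsQuantumSpace.exists_algHom_of_neg_one {R : Type*} [Ring R] [Algebra k R] {e y : R} {v : Rˣ}
    (h : IsQuantumSpace q (-1) e y v) : ∃ ρ : Alg q →ₐ[k] R, ρ (X q) = 0 ∧ ρ (Y q) = y ∧
      ρ (zOf (-1) (E q) (Y q) (K q)) = zOf (-1) e y v := by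
  obtain ⟨ρ, hE, hX, hY, hK⟩ := exists_algHom h.isAgeing_of_neg_one
  exact ⟨ρ, hX, hY, by rw [map_zOf, hE, hY, mapK_eq hK]⟩

theorem IsQuantumSpace.exists_algHom_of_one (hq0 : q ≠ 0) {R : Type*} [Ring R] [Algebra k R]
    {e y : R} {v : Rˣ} (h : IsQuantumSpace q 1 e y v) :
    ∃ ρ : Alg q →ₐ[k] R, ρ (phi q) = 0 ∧ ρ (Y q) = y ∧
      ρ (zOf 1 (E q) (Y q) (K q)) = zOf 1 e y v := by
  obtain ⟨ρ, hE, hX, hY, hK⟩ := exists_algHom (h.isAgeing_of_one hq0)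
  refine ⟨ρ, ?_, hY, by rw [map_zOf, hE, hY, mapK_eq hK]⟩
  rw [map_phi, phiOf, hE, hX, hY, ← add_smul, sub_add_sub_cancel, sub_self, zero_smul]

theorem isPrimeIdeal_span_X (hq0 : q ≠ 0) (hq : ∀ n : ℕ, 0 < n → q ^ n ≠ 1) :
    IsPrimeIdeal (TwoSidedIdeal.span {X q}) := by
  obtain ⟨e, y, v, h, hz⟩ := exists_isQuantumSpace hq0 (-1)
  obtain ⟨ρ, hX, hY, hρz⟩ := h.exists_algHom_of_neg_one
  have hker := eq_zero_of_mem_span (k := k) (q := q) (R := Module.End k[X] (ℤ →₀ k[X])) ρ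
    (s := {X q}) (by rintro _ rfl; exact hX)
  exact isPrimeIdeal_of_isQuantumSpace hq0 hq (-1)
    (fun π hπ => isQuantumSpace_of_X π (hπ _ (TwoSidedIdeal.subset_span rfl))) ρ
    hker (hρz.trans hz)
    (hY ▸ y.isUnit)

theorem isPrimeIdeal_span_phi (hq0 : q ≠ 0) (hq : ∀ n : ℕ, 0 < n → q ^ n ≠ 1) :
    IsPrimeIdeal (TwoSidedIdeal.span {phi q}) := by
  obtain ⟨e, y, v, h, hz⟩ := exists_isQuantumSpace hq0 1
  obtain ⟨ρ, hX, hY, hρz⟩ := h.exists_algHom_of_one hq0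
  have hker := eq_zero_of_mem_span (k := k) (q := q) (R := Module.End k[X] (ℤ →₀ k[X])) ρ
    (s := {phi q}) (by rintro _ rfl; exact hX)
  exact isPrimeIdeal_of_isQuantumSpace hq0 hq 1
    (fun π hπ => isQuantumSpace_of_phi π (hπ _ (TwoSidedIdeal.subset_span rfl))) ρ
    hker (hρz.trans hz)
    (hY ▸ y.isUnit)

/-- The ideal `(Y, E)` is prime: the quotient is the ring of Laurent polynomials in `K`. -/
theorem isPrimeIdeal_span_Y_E : IsPrimeIdeal (TwoSidedIdeal.span {Y q, E q}) := by
  set P := TwoSidedIdeal.span {Y q, E q} with hP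
  have hYP : Y q ∈ P := TwoSidedIdeal.subset_span (by simp)
  have hEP : E q ∈ P := TwoSidedIdeal.subset_span (by simp)
  let t : k[T;T⁻¹]ˣ := ⟨LaurentPolynomial.T 1, LaurentPolynomial.T (-1),
    by rw [← LaurentPolynomial.T_add]; simp, by rw [← LaurentPolynomial.T_add]; simp⟩
  have ht : ∀ n : ℤ, ((t ^ n : k[T;T⁻¹]ˣ) : k[T;T⁻¹]) = LaurentPolynomial.T n := by
    intro n
    induction n with
    | zero => simp
    | succ n ih => rw [zpow_add_one, Units.val_mul, ih, ← LaurentPolynomial.T_add]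
    | pred n ih => rw [zpow_sub_one, Units.val_mul, ih, sub_eq_add_neg, LaurentPolynomial.T_add]; rfl
  obtain ⟨ρ, hE, -, hY, hK⟩ := exists_algHom (q := q) (e := (0 : k[T;T⁻¹])) (x := 0) (y := 0)
    (v := t) ⟨qComm_zero_left _ _, qComm_zero_left _ _, qComm_zero_left _ _, qComm_zero_left _ _,
      qComm_zero_left _ _, by simp⟩
  have hρP := eq_zero_of_mem_span ρ (s := {Y q, E q}) (by rintro _ (rfl | rfl) <;> assumption)
  let T : Submonoid (Alg q) :=
    { carrier := {a | ρ a ≠ 0}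
      one_mem' := by simp
      mul_mem' := fun {a b} ha hb => by
        change ρ (a * b) ≠ 0
        rw [map_mul]
        exact mul_ne_zero ha hb }
  refine isPrimeIdeal_of_submonoid P T (fun a ha haP => ha (hρP a haP)) fun I hI => ?_
  obtain ⟨a, haI, haP⟩ := SetLike.exists_of_lt hI
  refine ⟨a, ?_, haI⟩
  obtain ⟨R, _, _, π, hπ, hker⟩ := exists_algHom_ker (k := k) P
  have hspan : ∃ c : ℤ →₀ k, c.sum (fun s t => t • ((mapK π ^ s : Rˣ) : R)) = π a := by
    have hsub : ∀ n : ℤ, ((mapK π ^ n : Rˣ) : R) ∈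
        Submodule.span k (Set.range fun n : ℤ => ((mapK π ^ n : Rˣ) : R)) :=
      fun n => Submodule.subset_span ⟨n, rfl⟩
    refine exists_finsupp_sum_eq π _ (by simpa using hsub 0) (fun s => ?_) (fun s => ?_)
      (fun s => ?_) (fun s => ?_) a
    · rw [(hker _).2 hEP, zero_mul]
      exact Submodule.zero_mem _
    · rw [(hker _).2 hYP, zero_mul]
      exact Submodule.zero_mem _
    · rw [← Units.val_mul, ← zpow_one_add]
      exact hsub _
    · rw [← Units.val_mul, ← zpow_neg_one, ← zpow_add]
      exact hsub _
  obtain ⟨c, hc⟩ := hspan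
  intro h0
  -- Modulo `P`, `a` is a Laurent polynomial in `K` with coefficients `c`. If `ρ a = 0`,
  -- independence of the powers of `T` forces `c = 0`, so `a ∈ P`.
  have hdiff : a - c.sum (fun s r => r • ((K q ^ s : (Alg q)ˣ) : Alg q)) ∈ P := by
    rw [← hker, map_sub, ← hc, map_finsuppSum, sub_eq_zero]
    refine Finsupp.sum_congr fun s _ => ?_
    rw [map_smul, ← map_zpow]
    rfl
  have h1 := hρP _ hdiff
  rw [map_sub, h0, zero_sub, neg_eq_zero, map_finsuppSum] at h1
  have h2 : ∀ s r, ρ (r • ((K q ^ s : (Alg q)ˣ) : Alg q)) = AddMonoidAlgebra.single s r := by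
    intro s r
    have h3 : ρ ((K q ^ s : (Alg q)ˣ) : Alg q) = ((t ^ s : k[T;T⁻¹]ˣ) : k[T;T⁻¹]) := by
      rw [← mapK_eq hK, ← map_zpow]
      rfl
    rw [map_smul, h3, ht, LaurentPolynomial.T, AddMonoidAlgebra.smul_single, smul_eq_mul, mul_one]
  simp only [h2] at h1
  have hc0 : c = 0 := by
    have h4 := congrArg AddMonoidAlgebra.coeff h1
    ext m
    have h5 := DFunLike.congr_fun h4 m
    have h6 : ∑ s ∈ c.support, (Finsupp.single s (c s)) m = 0 := by
      simpa [Finsupp.sum, -LaurentPolynomial.single_eq_C_mul_T] using h5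
    rw [← Finsupp.finsetSum_apply] at h6
    exact (DFunLike.congr_fun c.sum_single m).symm.trans h6
  refine haP ((hker a).1 ?_)
  rw [← hc, hc0, Finsupp.sum_zero_index]

end Primes

/-! ### Irreducible representations with kernels `(Y)`, `(E)` and `0` -/

section SimpleModules

variable {k : Type u} [Field k] {q : k}

/-- The eigenvalues `q^(dn)` of `g` are distinct, so a nonzero subrepresentation contains a basis
vector, and `K` and `K⁻¹` carry it to all the others. -/
theorem isIrreducibleRep_of_weightOp (hq0 : q ≠ 0) (hq : ∀ n : ℕ, 0 < n → q ^ n ≠ 1)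
    (ρ : Alg q →ₐ[k] Module.End k (ℤ →₀ k)) {g : Alg q} {d : ℤ} (hd : d ≠ 0)
    (hK : ρ (K q) = shiftOp k (Equiv.addLeft (1 : ℤ))) (hg : ρ g = weightOp hq0 k d) :
    IsIrreducibleRep ρ := by
  refine ⟨inferInstance, fun N hN => or_iff_not_imp_left.2 fun hne => ?_⟩
  obtain ⟨s, hs⟩ := exists_single_mem_of_diag (κ := Unit) (fun _ => ρ g) (fun _ n => q ^ (d * n))
    (fun _ n b => by
      rw [hg, weightOp, diagOp_single, qUnit_zpow]
      rfl)
    (fun n m hnm => ⟨(), fun h => hnm (mul_left_cancel₀ hd (zpow_inj_of_not_root hq0 hq h))⟩)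
    N (fun _ f hf => hN g f hf) hne
  have hK' : ρ ((K q)⁻¹ : (Alg q)ˣ) = ((shiftOp k (Equiv.addLeft (1 : ℤ)))⁻¹ : Units _) := by
    rw [← mapK_eq (R := Module.End k (ℤ →₀ k)) hK]
    rfl
  have hup : ∀ n : ℤ, Finsupp.single n (1 : k) ∈ N → Finsupp.single (n + 1) (1 : k) ∈ N := by
    intro n hn
    have := hN (K q) _ hn
    rw [hK, shiftOp_single] at this
    simpa [add_comm] using this
  have hdown : ∀ n : ℤ, Finsupp.single n (1 : k) ∈ N → Finsupp.single (n - 1) (1 : k) ∈ N := by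
    intro n hn
    have := hN ((K q)⁻¹ : (Alg q)ˣ) _ hn
    rw [hK', shiftOp_inv_single] at this
    simpa [add_comm, sub_eq_add_neg] using this
  refine eq_top_of_single_mem N fun n => ?_
  have hall : ∀ m : ℤ, Finsupp.single (s + m) (1 : k) ∈ N := by
    intro m
    induction m with
    | zero => simpa using hs
    | succ m ih => rw [← add_assoc]; exact hup _ ih
    | pred m ih => rw [← add_sub_assoc]; exact hdown _ ih
  simpa using hall (n - s)

/-- Besides realising `(Y)` as a kernel, this representation certifies that `E` lies outside `(X)`,
`(Y)` and `(φ)`. -/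
theorem exists_irreducibleRep_E (hq0 : q ≠ 0) (hq : ∀ n : ℕ, 0 < n → q ^ n ≠ 1) :
    ∃ ρ : Alg q →ₐ[k] Module.End k (ℤ →₀ k),
      IsIrreducibleRep ρ ∧ ρ (Y q) = 0 ∧ ρ (X q) = 0 ∧ IsUnit (ρ (E q)) := by
  obtain ⟨ρ, hE, hX, hY, hK⟩ := exists_algHom (q := q)
    (e := (weightOp hq0 k (-2) : Module.End k (ℤ →₀ k))) (x := 0) (y := 0)
    (v := shiftOp k (Equiv.addLeft (1 : ℤ))) ⟨weightOp_shiftOp hq0 k (-2), qComm_zero_left _ _,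
      qComm_zero_left _ _, qComm_zero_right _ _, qComm_zero_left _ _, by simp⟩
  exact ⟨ρ, isIrreducibleRep_of_weightOp hq0 hq ρ (by norm_num) hK hE, hY, hX, hE ▸ Units.isUnit _⟩

theorem exists_irreducibleRep_Y (hq0 : q ≠ 0) (hq : ∀ n : ℕ, 0 < n → q ^ n ≠ 1) :
    ∃ ρ : Alg q →ₐ[k] Module.End k (ℤ →₀ k),
      IsIrreducibleRep ρ ∧ ρ (E q) = 0 ∧ ρ (X q) = 0 ∧ IsUnit (ρ (Y q)) := by
  obtain ⟨ρ, hE, hX, hY, hK⟩ := exists_algHom (q := q)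
    (R := Module.End k (ℤ →₀ k)) (e := 0) (x := 0) (y := (weightOp hq0 k 1 : Module.End k (ℤ →₀ k)))
    (v := shiftOp k (Equiv.addLeft (1 : ℤ))) ⟨qComm_zero_left _ _, qComm_zero_left _ _,
      weightOp_shiftOp hq0 k 1, qComm_zero_left _ _, qComm_zero_left _ _, by simp⟩
  exact ⟨ρ, isIrreducibleRep_of_weightOp hq0 hq ρ (by norm_num) hK hY, hE, hX, hY ▸ Units.isUnit _⟩

/-- An ideal modulo which the algebra is generated by `K` and a `q`-commuting element `g` is the
kernel of every representation killing it in which `g` is invertible. -/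
theorem mem_iff_of_isUnit (hq0 : q ≠ 0) (hq : ∀ n : ℕ, 0 < n → q ^ n ≠ 1)
    {R : Type*} [Ring R] [Nontrivial R] [Algebra k R] (ρ : Alg q →ₐ[k] R) {P : TwoSidedIdeal (Alg q)}
    (hρP : ∀ a ∈ P, ρ a = 0) {g : Alg q} {d : ℤ} (hd : d ≠ 0) (hg : QComm q d g (K q : Alg q))
    (hE : E q ∈ P ∨ E q = g) (hY : Y q ∈ P ∨ Y q = g) (hu : IsUnit (ρ g)) (a : Alg q) :
    a ∈ P ↔ ρ a = 0 := by
  refine ⟨hρP a, fun ha => ?_⟩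
  by_contra haP
  have hle : P ≤ TwoSidedIdeal.ker ρ.toRingHom := fun b hb =>
    (TwoSidedIdeal.mem_ker _).2 (hρP b hb)
  have hlt : P < TwoSidedIdeal.ker ρ.toRingHom :=
    lt_of_le_of_ne hle fun h => haP (h ▸ (TwoSidedIdeal.mem_ker _).2 ha)
  obtain ⟨j, hj⟩ := exists_pow_mem_of_lt hq0 hq hlt hd hg hE hY
  have h0 : ρ (g ^ j) = 0 := (TwoSidedIdeal.mem_ker _).1 hj
  rw [map_pow] at h0
  exact (hu.pow j).ne_zero h0

theorem isPrimitiveIdeal_span_Y (hq0 : q ≠ 0) (hq : ∀ n : ℕ, 0 < n → q ^ n ≠ 1) :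
    IsPrimitiveIdeal (TwoSidedIdeal.span {Y q}) := by
  obtain ⟨ρ, hρ, hY, -, hE⟩ := exists_irreducibleRep_E hq0 hq
  have hker := eq_zero_of_mem_span (k := k) (q := q) (R := Module.End k (ℤ →₀ k)) ρ
    (s := {Y q}) (by rintro _ rfl; exact hY)
  exact isPrimitiveIdeal_of_rep ρ hρ (mem_iff_of_isUnit hq0 hq (R := Module.End k (ℤ →₀ k)) ρ hker
    (by norm_num) (isAgeing_alg q).e_v (Or.inr rfl) (Or.inl (TwoSidedIdeal.subset_span (Set.mem_singleton _))) hE)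

theorem isPrimitiveIdeal_span_E (hq0 : q ≠ 0) (hq : ∀ n : ℕ, 0 < n → q ^ n ≠ 1) :
    IsPrimitiveIdeal (TwoSidedIdeal.span {E q}) := by
  obtain ⟨ρ, hρ, hE, -, hY⟩ := exists_irreducibleRep_Y hq0 hq
  have hker := eq_zero_of_mem_span (k := k) (q := q) (R := Module.End k (ℤ →₀ k)) ρ
    (s := {E q}) (by rintro _ rfl; exact hE)
  exact isPrimitiveIdeal_of_rep ρ hρ (mem_iff_of_isUnit hq0 hq (R := Module.End k (ℤ →₀ k)) ρ hker
    (by norm_num) (isAgeing_alg q).y_v (Or.inl (TwoSidedIdeal.subset_span (Set.mem_singleton _))) (Or.inr rfl) hY)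

/-- The diagonal operator `q^(α n + β m + γ)` on functions on `ℤ × ℤ`. -/
noncomputable def weightOp₂ (hq0 : q ≠ 0) (α β γ : ℤ) : (Module.End k (ℤ × ℤ →₀ k))ˣ :=
  diagOp fun s => qUnit hq0 k ^ (α * s.1 + β * s.2 + γ)

/-- The translation operator on functions on `ℤ × ℤ`. -/
noncomputable def shiftOp₂ (k : Type*) [Field k] (t : ℤ × ℤ) : (Module.End k (ℤ × ℤ →₀ k))ˣ :=
  shiftOp k (Equiv.addLeft t)

theorem weightOp₂_single (hq0 : q ≠ 0) (α β γ : ℤ) (s : ℤ × ℤ) (b : k) :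
    (weightOp₂ hq0 α β γ : Module.End k (ℤ × ℤ →₀ k)) (Finsupp.single s b)
      = Finsupp.single s (q ^ (α * s.1 + β * s.2 + γ) * b) := by
  rw [weightOp₂, diagOp_single, qUnit_zpow]
  rfl

theorem weightOp₂_shiftOp₂ (hq0 : q ≠ 0) (α β γ : ℤ) (t : ℤ × ℤ) :
    QComm q (α * t.1 + β * t.2) (weightOp₂ hq0 α β γ : Module.End k (ℤ × ℤ →₀ k))
      (shiftOp₂ k t : Module.End k (ℤ × ℤ →₀ k)) :=
  diagOp_shiftOp _ _ fun s => by
    rw [← qUnit_zpow_add, Equiv.coe_addLeft, Prod.fst_add, Prod.snd_add]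
    congr 2
    ring

theorem QComm.sub_left {R : Type*} [Ring R] [Algebra k R] {n : ℤ} {a b c : R} (h : QComm q n a c)
    (h' : QComm q n b c) : QComm q n (a - b) c := by
  unfold QComm at *
  rw [sub_mul, h, h', mul_sub, smul_sub]

/-- When `Y` is invertible, `E` can be recovered from `X` and `φ` through `(q⁻¹ - q)YE = φ - X`, so
prescribing `K`, `Y`, `X`, `φ` with monomial relations is enough. -/
theorem isAgeing_of_units (hq0 : q ≠ 0) (hq : ∀ n : ℕ, 0 < n → q ^ n ≠ 1) {R : Type*} [Ring R]
    [Algebra k R] {y v : Rˣ} {x φ : R} (hx : QComm q (-1) x (v : R)) (hφ : QComm q (-1) φ (v : R))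
    (hy : QComm q 1 (y : R) (v : R)) (hxy : QComm q 1 x (y : R)) (hφy : QComm q (-1) φ (y : R))
    (hφx : QComm q 0 φ x) :
    IsAgeing q ((y⁻¹ : Rˣ) * ((q⁻¹ - q)⁻¹ • (φ - x))) x (y : R) v ∧
      phiOf q ((y⁻¹ : Rˣ) * ((q⁻¹ - q)⁻¹ • (φ - x))) x (y : R) = φ := by
  have hδ := inv_sub_ne_zero hq0 hq
  have hye : (y : R) * ((y⁻¹ : Rˣ) * ((q⁻¹ - q)⁻¹ • (φ - x))) = (q⁻¹ - q)⁻¹ • (φ - x) :=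
    Units.mul_inv_cancel_left _ _
  have hsm : ∀ {n : ℤ} {c : R}, QComm q n (φ - x) c → QComm q n ((q⁻¹ - q)⁻¹ • (φ - x)) c :=
    fun {n c} h => (((h.symm hq0).smul_right _).symm hq0).congr (neg_neg n)
  refine ⟨⟨?_, hx, hy, ?_, hxy, ?_⟩, ?_⟩
  · exact (QComm.mul_left hq0 (((hy.symm hq0).inv_right hq0).symm hq0)
      (hsm (hφ.sub_left hx))).congr (by norm_num)
  · exact (QComm.mul_left hq0 ((hxy.inv_right hq0).symm hq0)
      (hsm (hφx.sub_left (QComm.refl x)))).congr (by norm_num)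
  · rw [hye]
    unfold QComm at hφy hxy
    rw [mul_assoc, smul_mul_assoc, sub_mul, hφy, hxy, ← mul_smul_comm, ← mul_smul_comm, ← mul_sub,
      ← mul_smul_comm, Units.inv_mul_cancel_left, ← smul_right_inj hδ, smul_smul, smul_add,
      mul_inv_cancel₀ hδ, one_smul, smul_comm (q⁻¹ - q), smul_smul (q⁻¹ - q), mul_inv_cancel₀ hδ,
      one_smul, zpow_neg_one, zpow_one, sub_smul, smul_sub]
    abel
  · rw [phiOf, hye, smul_smul, mul_inv_cancel₀ hδ, one_smul, add_sub_cancel]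

/-- There is an irreducible representation on which `X` and `φ` are invertible. -/
theorem exists_irreducibleRep_X_phi (hq0 : q ≠ 0) (hq : ∀ n : ℕ, 0 < n → q ^ n ≠ 1) :
    ∃ ρ : Alg q →ₐ[k] Module.End k (ℤ × ℤ →₀ k),
      IsIrreducibleRep ρ ∧ IsUnit (ρ (X q)) ∧ IsUnit (ρ (phi q)) := by
  let A := Module.End k (ℤ × ℤ →₀ k)
  set v := shiftOp₂ k (1, 0) with hv
  set y := shiftOp₂ k (0, 1) * weightOp₂ hq0 1 0 0 with hy
  set x : A := ((weightOp₂ hq0 (-1) 1 0 : Aˣ) : A) with hx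
  -- The offset `1` is a parity device: the eigenvalues `q^(-n-m+1)` of `φ` and `q^(-n+m)` of `X`
  -- never agree, since `2m ≠ 1`. Hence `E`, a multiple of `Y⁻¹(φ - X)`, kills no basis vector.
  set φ : A := ((weightOp₂ hq0 (-1) (-1) 1 : Aˣ) : A) with hφ
  have hvv : QComm q 0 (shiftOp₂ k (0, 1) : A) (v : A) :=
    shiftOp_shiftOp q _ _ fun s => by simp [add_left_comm]
  have hyc : ∀ {n : ℤ} {a : A}, QComm q n a (shiftOp₂ k (0, 1) : A) →
      QComm q 0 a (weightOp₂ hq0 1 0 0 : A) → QComm q n a (y : A) := by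
    intro n a h h'
    exact (h.mul_right hq0 h').congr (add_zero n)
  have hag := isAgeing_of_units hq0 hq (R := A) (y := y) (v := v) (x := x) (φ := φ)
    ((weightOp₂_shiftOp₂ hq0 (-1) 1 0 (1, 0)).congr (by norm_num))
    ((weightOp₂_shiftOp₂ hq0 (-1) (-1) 1 (1, 0)).congr (by norm_num))
    ((QComm.mul_left hq0 hvv (weightOp₂_shiftOp₂ hq0 1 0 0 (1, 0))).congr (by norm_num))
    (hyc ((weightOp₂_shiftOp₂ hq0 (-1) 1 0 (0, 1)).congr (by norm_num)) (diagOp_diagOp _ _ _))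
    (hyc ((weightOp₂_shiftOp₂ hq0 (-1) (-1) 1 (0, 1)).congr (by norm_num)) (diagOp_diagOp _ _ _))
    (diagOp_diagOp _ _ _)
  obtain ⟨ρ, hE, hX, hY, hK⟩ := exists_algHom hag.1
  have hphi : ρ (phi q) = φ := by
    have := map_phi (R := A) ρ
    rw [this, hE, hX, hY, hag.2]
  refine ⟨ρ, ⟨inferInstance, fun N hN => or_iff_not_imp_left.2 fun hne => ?_⟩,
    hX ▸ Units.isUnit _, hphi ▸ Units.isUnit _⟩
  obtain ⟨s, hs⟩ := exists_single_mem_of_diag (κ := Bool) (fun b => cond b x φ)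
    (fun b s => cond b (q ^ (-1 * s.1 + 1 * s.2 + 0)) (q ^ (-1 * s.1 + -1 * s.2 + 1)))
    (fun i s b => by cases i <;> exact weightOp₂_single _ _ _ _ _ _)
    (fun s t hst => by
      by_contra! h
      have h1 := zpow_inj_of_not_root hq0 hq (h true)
      have h2 := zpow_inj_of_not_root hq0 hq (h false)
      exact hst (Prod.ext (by omega) (by omega)))
    N (fun i f hf => by
      cases i
      · exact hphi ▸ hN (phi q) f hf
      · exact hX ▸ hN (X q) f hf) hne
  have hK' : ρ ((K q)⁻¹ : (Alg q)ˣ) = (v⁻¹ : Units _) := by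
    rw [← mapK_eq (R := A) hK]
    rfl
  have hys : ∀ n m : ℤ, (y : A) (Finsupp.single (n, m) 1) = q ^ n • Finsupp.single (n, m + 1) 1 := by
    intro n m
    rw [hy, Units.val_mul, Module.End.mul_apply, weightOp₂_single, shiftOp₂, shiftOp_single,
      Finsupp.smul_single]
    simp [add_comm]
  have hn1 : ∀ n m : ℤ, Finsupp.single (n, m) (1 : k) ∈ N → Finsupp.single (n + 1, m) (1 : k) ∈ N := by
    intro n m h
    have := hN (K q) _ h
    rw [hK, hv, shiftOp₂, shiftOp_single] at this
    simpa [add_comm] using this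
  have hn2 : ∀ n m : ℤ, Finsupp.single (n, m) (1 : k) ∈ N → Finsupp.single (n - 1, m) (1 : k) ∈ N := by
    intro n m h
    have := hN ((K q)⁻¹ : (Alg q)ˣ) _ h
    rw [hK', hv, shiftOp₂, shiftOp_inv_single] at this
    simpa [add_comm, sub_eq_add_neg] using this
  have hm1 : ∀ n m : ℤ, Finsupp.single (n, m) (1 : k) ∈ N → Finsupp.single (n, m + 1) (1 : k) ∈ N := by
    intro n m h
    have := hN (Y q) _ h
    rwa [hY, hys, N.smul_mem_iff (zpow_ne_zero _ hq0)] at this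
  have hm2 : ∀ n m : ℤ, Finsupp.single (n, m) (1 : k) ∈ N → Finsupp.single (n, m - 1) (1 : k) ∈ N := by
    intro n m h
    have h1 := hN (E q) _ h
    have h2 : (φ - x) (Finsupp.single (n, m) 1)
        = (q ^ (-1 * n + -1 * m + 1) - q ^ (-1 * n + 1 * m + 0)) • Finsupp.single (n, m) (1 : k) := by
      rw [LinearMap.sub_apply, hφ, hx, weightOp₂_single, weightOp₂_single, sub_smul,
        Finsupp.smul_single, Finsupp.smul_single]
      rfl
    have h3 : ((y⁻¹ : Units A) : A) (Finsupp.single (n, m) 1)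
        = (q ^ n)⁻¹ • Finsupp.single (n, m - 1) (1 : k) := by
      have h4 := hys n (m - 1)
      rw [sub_add_cancel] at h4
      have h5 := congrArg ((y⁻¹ : Units A) : A) h4
      rw [← Module.End.mul_apply, Units.inv_mul, Module.End.one_apply, map_smul] at h5
      rw [h5, smul_smul, inv_mul_cancel₀ (zpow_ne_zero _ hq0), one_smul]
    rw [hE, Module.End.mul_apply, LinearMap.smul_apply, h2, map_smul, map_smul, h3,
      N.smul_mem_iff (inv_ne_zero (inv_sub_ne_zero hq0 hq)), N.smul_mem_iff, N.smul_mem_iff] at h1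
    · exact h1
    · exact inv_ne_zero (zpow_ne_zero _ hq0)
    · intro h0
      have := zpow_inj_of_not_root hq0 hq (sub_eq_zero.1 h0)
      omega
  obtain ⟨n₀, m₀⟩ := s
  have hall1 : ∀ n : ℤ, Finsupp.single (n₀ + n, m₀) (1 : k) ∈ N := by
    intro n
    induction n with
    | zero => simpa using hs
    | succ n ih => rw [← add_assoc]; exact hn1 _ _ ih
    | pred n ih => rw [← add_sub_assoc]; exact hn2 _ _ ih
  have hall2 : ∀ n m : ℤ, Finsupp.single (n₀ + n, m₀ + m) (1 : k) ∈ N := by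
    intro n m
    induction m with
    | zero => simpa using hall1 n
    | succ m ih => rw [← add_assoc]; exact hm1 _ _ ih
    | pred m ih => rw [← add_sub_assoc]; exact hm2 _ _ ih
  refine eq_top_of_single_mem N fun s => ?_
  simpa using hall2 (s.1 - n₀) (s.2 - m₀)

/-- A nonzero kernel would contain some `Xⁱφʲ`, which acts invertibly. -/
theorem isPrimitiveIdeal_bot (hq0 : q ≠ 0) (hq : ∀ n : ℕ, 0 < n → q ^ n ≠ 1) :
    IsPrimitiveIdeal (⊥ : TwoSidedIdeal (Alg q)) := by
  obtain ⟨ρ, hρ, hX, hphi⟩ := exists_irreducibleRep_X_phi hq0 hq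
  refine isPrimitiveIdeal_of_rep ρ hρ fun a => ?_
  rw [TwoSidedIdeal.mem_bot]
  refine ⟨fun h => by rw [h, map_zero], fun ha => ?_⟩
  by_contra ha0
  obtain ⟨i, j, hij⟩ := exists_X_pow_mul_phi_pow_mem hq0 hq (TwoSidedIdeal.ker ρ.toRingHom)
    ((TwoSidedIdeal.mem_ker _).2 ha) ha0
  have h0 : ρ (X q ^ i * phi q ^ j) = 0 := (TwoSidedIdeal.mem_ker _).1 hij
  rw [map_mul, map_pow, map_pow] at h0
  exact ((hX.pow i).mul (hphi.pow j)).ne_zero h0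

/-- The character of the algebra killing `E`, `X`, `Y` and sending `K` to `c`. -/
theorem exists_character (q : k) (c : kˣ) : ∃ χ : Alg q →ₐ[k] k,
    χ (E q) = 0 ∧ χ (X q) = 0 ∧ χ (Y q) = 0 ∧ χ (K q) = c :=
  exists_algHom ⟨qComm_zero_left _ _, qComm_zero_left _ _, qComm_zero_left _ _,
    qComm_zero_left _ _, qComm_zero_left _ _, by simp⟩

end SimpleModules

end QuantumAgeing

/-! ### Assembly of the classification -/

open QuantumAgeing

theorem proposition2 {𝕜 : Type*} [Field 𝕜] (q : 𝕜) (hq0 : q ≠ 0)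
    (hq : ∀ n : ℕ, 0 < n → q ^ n ≠ 1) :
    -- the primitive spectrum is the disjoint union of the maximal one and three more ideals
    QuantumAgeing.Prim (QuantumAgeing.Alg q) =
        QuantumAgeing.Max (QuantumAgeing.Alg q) ∪
          {TwoSidedIdeal.span {QuantumAgeing.Y q}, TwoSidedIdeal.span {QuantumAgeing.E q}, ⊥} ∧
      Disjoint (QuantumAgeing.Max (QuantumAgeing.Alg q))
        {TwoSidedIdeal.span {QuantumAgeing.Y q}, TwoSidedIdeal.span {QuantumAgeing.E q}, ⊥} ∧
      -- the three ideals are pairwise distinct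
      TwoSidedIdeal.span {QuantumAgeing.Y q} ≠ TwoSidedIdeal.span {QuantumAgeing.E q} ∧
      TwoSidedIdeal.span {QuantumAgeing.Y q} ≠ ⊥ ∧
      TwoSidedIdeal.span {QuantumAgeing.E q} ≠ ⊥ ∧
      -- the ideals `(X)`, `(φ)` and `(Y, E)` are prime and not primitive
      (∀ P ∈ ({TwoSidedIdeal.span {QuantumAgeing.X q}, TwoSidedIdeal.span {QuantumAgeing.phi q},
            TwoSidedIdeal.span {QuantumAgeing.Y q, QuantumAgeing.E q}} :
            Set (TwoSidedIdeal (QuantumAgeing.Alg q))),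
        QuantumAgeing.IsPrimeIdeal P ∧ ¬ QuantumAgeing.IsPrimitiveIdeal P) := by
  obtain ⟨ρE, -, hEY, hEX, hEE⟩ := exists_irreducibleRep_E hq0 hq
  obtain ⟨ρY, -, hYE, hYX, hYY⟩ := exists_irreducibleRep_Y hq0 hq
  -- The kernel of `χ` is a proper ideal above all ideals to be shown non-maximal. The second
  -- character, with `K ↦ q ≠ 1`, only shows that `K - 1` is outside `(Y, E)`.
  obtain ⟨χ, hχE, hχX, hχY, hχK⟩ := exists_character q 1
  obtain ⟨χ', hχE', hχX', hχY', hχK'⟩ := exists_character q (Units.mk0 q hq0)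
  have hkerE : ∀ (s : Set (Alg q)), (∀ a ∈ s, ρE a = 0) → E q ∉ TwoSidedIdeal.span s :=
    fun s hs h => hEE.ne_zero
      (eq_zero_of_mem_span (R := Module.End 𝕜 (ℤ →₀ 𝕜)) ρE hs _ h)
  have hkerY : ∀ (s : Set (Alg q)), (∀ a ∈ s, ρY a = 0) → Y q ∉ TwoSidedIdeal.span s :=
    fun s hs h => hYY.ne_zero
      (eq_zero_of_mem_span (R := Module.End 𝕜 (ℤ →₀ 𝕜)) ρY hs _ h)
  have hE_Y : E q ∉ TwoSidedIdeal.span {Y q} := hkerE _ (by rintro _ rfl; exact hEY)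
  have hY_E : Y q ∉ TwoSidedIdeal.span {E q} := hkerY _ (by rintro _ rfl; exact hYE)
  have hphiE : ρE (phi q) = 0 := by
    rw [map_phi (R := Module.End 𝕜 (ℤ →₀ 𝕜)), phiOf, hEX, hEY, zero_mul, smul_zero, add_zero]
  have hphiY : ρY (phi q) = 0 := by
    rw [map_phi (R := Module.End 𝕜 (ℤ →₀ 𝕜)), phiOf, hYX, hYE, mul_zero, smul_zero, add_zero]
  have hphiχ : χ (phi q) = 0 := by rw [map_phi, phiOf, hχX, hχY, zero_mul, smul_zero, add_zero]
  have hY0 : Y q ≠ 0 := fun h => hYY.ne_zero (by rw [h, map_zero])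
  have hE0 : E q ≠ 0 := fun h => hEE.ne_zero (by rw [h, map_zero])
  set M := TwoSidedIdeal.ker χ.toRingHom with hM
  have hmemM : ∀ a, a ∈ M ↔ χ a = 0 := fun a => TwoSidedIdeal.mem_ker _
  have hM1 : M ≠ ⊤ := by
    intro h
    have h1 := (hmemM 1).1 (h ▸ trivial)
    rw [map_one] at h1
    exact one_ne_zero h1
  have hnot : ∀ (s : Set (Alg q)) (a : Alg q), (∀ b ∈ s, χ b = 0) → χ a = 0 →
      a ∉ TwoSidedIdeal.span s → ¬ IsCoatom (TwoSidedIdeal.span s) := by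
    intro s a hs ha has hco
    refine hM1 (hco.2 M (lt_of_le_of_ne ?_ ?_))
    · exact TwoSidedIdeal.span_le.2 fun b hb => (hmemM b).2 (hs b hb)
    · intro h
      exact has (h ▸ (hmemM a).2 ha)
  have hnotY : ¬ IsCoatom (TwoSidedIdeal.span {Y q}) :=
    hnot _ (E q) (by rintro _ rfl; exact hχY) hχE hE_Y
  have hnotE : ¬ IsCoatom (TwoSidedIdeal.span {E q}) :=
    hnot _ (Y q) (by rintro _ rfl; exact hχE) hχY hY_E
  have hnot0 : ¬ IsCoatom (⊥ : TwoSidedIdeal (Alg q)) := by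
    intro hco
    refine hM1 (hco.2 M (bot_lt_iff_ne_bot.2 fun h => hY0 ?_))
    rw [← TwoSidedIdeal.mem_bot, ← h, hmemM, hχY]
  refine ⟨?_, ?_, ?_, ?_, ?_, ?_⟩
  · ext P
    simp only [Prim, QuantumAgeing.Max, Set.mem_union, Set.mem_ofPred_eq, Set.mem_insert_iff,
      Set.mem_singleton_iff]
    refine ⟨fun h => h.isCoatom_or hq0 hq, ?_⟩
    rintro (h | rfl | rfl | rfl)
    · exact isPrimitiveIdeal_of_isCoatom h
    · exact isPrimitiveIdeal_span_Y hq0 hq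
    · exact isPrimitiveIdeal_span_E hq0 hq
    · exact isPrimitiveIdeal_bot hq0 hq
  · rw [Set.disjoint_left]
    rintro P hP (rfl | rfl | rfl)
    · exact hnotY hP
    · exact hnotE hP
    · exact hnot0 hP
  · intro h
    exact hE_Y (h ▸ TwoSidedIdeal.subset_span rfl)
  · intro h
    have h1 : Y q ∈ TwoSidedIdeal.span {Y q} := TwoSidedIdeal.subset_span rfl
    rw [h, TwoSidedIdeal.mem_bot] at h1
    exact hY0 h1
  · intro h
    have h1 : E q ∈ TwoSidedIdeal.span {E q} := TwoSidedIdeal.subset_span rfl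
    rw [h, TwoSidedIdeal.mem_bot] at h1
    exact hE0 h1
  · rintro P (rfl | rfl | rfl)
    · have hYX' : Y q ∉ TwoSidedIdeal.span {X q} := hkerY _ (by rintro _ rfl; exact hYX)
      have hEX' : E q ∉ TwoSidedIdeal.span {X q} := hkerE _ (by rintro _ rfl; exact hEX)
      -- Primitivity would imply maximality, as neither `E` nor `Y` lies in the ideal; but `Y`
      -- belongs to the strictly larger proper ideal `M`.
      exact ⟨isPrimeIdeal_span_X hq0 hq, fun h =>
        hnot _ (Y q) (by rintro _ rfl; exact hχX) hχY hYX'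
          (isCoatom_of_X_mem hq0 hq h (TwoSidedIdeal.subset_span (Set.mem_singleton _)) hEX' hYX')⟩
    · have hYφ : Y q ∉ TwoSidedIdeal.span {phi q} := hkerY _ (by rintro _ rfl; exact hphiY)
      have hEφ : E q ∉ TwoSidedIdeal.span {phi q} := hkerE _ (by rintro _ rfl; exact hphiE)
      exact ⟨isPrimeIdeal_span_phi hq0 hq, fun h =>
        hnot _ (Y q) (by rintro _ rfl; exact hphiχ) hχY hYφ
          (isCoatom_of_phi_mem hq0 hq h (TwoSidedIdeal.subset_span (Set.mem_singleton _)) hEφ hYφ)⟩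
    · refine ⟨isPrimeIdeal_span_Y_E, fun h => hnot _ ((K q : Alg q) - 1) ?_ ?_ ?_
        (isCoatom_of_Y_mem_of_E_mem h (TwoSidedIdeal.subset_span (by simp))
          (TwoSidedIdeal.subset_span (by simp)))⟩
      · rintro _ (rfl | rfl) <;> assumption
      · rw [map_sub, hχK, map_one, Units.val_one, sub_self]
      · intro hmem
        have h1 := eq_zero_of_mem_span χ' (s := {Y q, E q})
          (by rintro _ (rfl | rfl) <;> assumption) _ hmem
        rw [map_sub, hχK', map_one, Units.val_mk0, sub_eq_zero] at h1
        exact hq 1 one_pos (by rw [pow_one, h1])
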